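/- Let $\ell\ge 1$ be an integer and $p,q\ge 0$ with $p+q\le 1$; logarithms are to base 2. The one-bit deletion and duplication channel takes a block $X^\ell\in\{0,1\}^\ell$ and outputs the string $\mathbf Y$ obtained from it as follows: with probability $p$ one bit, chosen uniformly, is deleted; with probability $q$ one bit, chosen uniformly, is duplicated; with probability $1-p-q$ the block is unchanged. Let $C_{SI}=\frac1\ell\max_{X^\ell} I(X^\ell;\mathbf Y)$ be its capacity, the maximum being over all laws of $X^\ell$, and let $L_{SI}^{0.5}=\frac1\ell I(X^\ell;\mathbf Y)$ for the Markov input with $\Pr(X_1=0)=\Pr(X_1=1)=\tfrac12$ and $\Pr(X_i\ne X_{i-1})=\tfrac12$ (that is, for $X^\ell$ uniform on $\{0,1\}^\ell$). For $p+q<1$ let $$U=\frac{p(\ell-1)+q\log(2^{\ell+1}-2)}{\ell}+\frac{1-p-q}{\ell}\log\sum_{x\in\{0,1\}^\ell}2^{-\frac{p+q}{1-p-q}\hat H(x)},\qquad \hat H(x)=-\sum_{i}\frac{r_i(x)}{\ell}\log\frac{r_i(x)}{\ell},$$ where $r_1(x),r_2(x),\dots$ are the lengths of the runs (maximal blocks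 of equal consecutive bits) of $x$. Put $$K=\sum_{j=1}^\infty\frac{j\log j}{2^{j+1}},\qquad E(\ell,p,q)=1-\frac{p+q}{\ell}\log\ell+\frac p\ell(K-1)+\frac q\ell(K+1).$$ The series $K$ converges, and $K\simeq 1.2885$ (correct to four decimals). All $O$-constants below are uniform in $p,q$. (i) As $\ell\to\infty$, for $p,q\ge 0$ with $p+q\le 1$, $$L_{SI}^{0.5}=E(\ell,p,q)+(p+q)\,O(\ell^{-2}).$$ (ii) As $\ell\to\infty$ and $(p+q)\log\ell\to 0$, $$U=E(\ell,p,q)+(p+q)\,O(\ell^{-2})+O\big((p+q)^2(\log\ell)^2/\ell\big).$$ If moreover, for some fixed $c>0$, either $p+q=0$ or $(p+q)\,\ell(\log\ell)^2\ge c$, then $$U=E(\ell,p,q)+O\big((p+q)^2(\log\ell)^2/\ell\big),$$ with an $O$-constant that may depend on $c$. (iii) As $\ell\to\infty$ and $(p+q)\log\ell\to 0$, $$C_{SI}=E(\ell,p,q)+(p+q)\,O(\ell^{-2})+O\big((p+q)^2(\log\ell)^2/\ell\big).$$ Here "$f=O(g)$ as $\ell\to\infty$ and $(p+q)\log\ell\to0$"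 means that there are constants $\delta>0$, $k$ and $\ell_0$ with $|f|\le k\,g$ for all $\ell\ge\ell_0$ and all $p,q\ge 0$ with $p+q\le1$ and $(p+q)\log\ell\le\delta$ (and the further condition, if any). -/

import Mathlib

namespace OneBit

noncomputable section

/-- The block `x` of length `ℓ` with its bit at position `i` deleted. -/
def deleteBit {ℓ : ℕ} (x : Fin ℓ → Bool) (i : Fin ℓ) : Fin (ℓ - 1) → Bool := fun j =>
  if (j : ℕ) < i then x ⟨j, by omega⟩ else x ⟨j + 1, by omega⟩

/-- The block `x` of length `ℓ` with its bit at position `i` duplicated. -/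
def duplicateBit {ℓ : ℕ} (x : Fin ℓ → Bool) (i : Fin ℓ) : Fin (ℓ + 1) → Bool := fun j =>
  if _h : (j : ℕ) ≤ i then x ⟨j, by omega⟩ else x ⟨j - 1, by omega⟩

/-- The output strings: binary strings of length `ℓ - 1`, `ℓ` or `ℓ + 1`. -/
abbrev Output (ℓ : ℕ) : Type :=
  (Fin (ℓ - 1) → Bool) ⊕ (Fin ℓ → Bool) ⊕ (Fin (ℓ + 1) → Bool)

/-- `channel p q x y` is the probability of the output `y` given the input block `x`: with
probability `p` a uniformly chosen bit is deleted, with probability `q` a uniformly chosen bit is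
duplicated, and with probability `1 - p - q` the block is unchanged. -/
def channel {ℓ : ℕ} (p q : ℝ) (x : Fin ℓ → Bool) : Output ℓ → ℝ
  | .inl y => ∑ i : Fin ℓ, if deleteBit x i = y then p / ℓ else 0
  | .inr (.inl y) => if x = y then 1 - p - q else 0
  | .inr (.inr y) => ∑ i : Fin ℓ, if duplicateBit x i = y then q / ℓ else 0

/-- Shannon entropy, in bits, of a probability vector. -/
def entropy {α : Type*} [Fintype α] (P : α → ℝ) : ℝ :=
  -∑ a, P a * Real.logb 2 (P a)

/-- Mutual information `I(X;Y) = H(Y) - H(Y|X)`, in bits, between an input `X` of law `P` and the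
output `Y` of the channel with transition probabilities `W`. -/
def mutualInfo {α β : Type*} [Fintype α] [Fintype β] (P : α → ℝ) (W : α → β → ℝ) : ℝ :=
  entropy (fun y => ∑ x, P x * W x y) - ∑ x, P x * entropy (W x)

/-- The law of the Markov input: the first bit is uniform, and each later bit differs from the
previous one with probability `α`. -/
def markovInput (ℓ : ℕ) (α : ℝ) (x : Fin ℓ → Bool) : ℝ :=
  ∏ i : Fin ℓ, if (i : ℕ) = 0 then 1 / 2
    else if x i ≠ x ⟨i - 1, by omega⟩ then α else 1 - α

/-- The normalized mutual information `L_SI^α` achieved by the Markov input. -/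
def lowerBound (ℓ : ℕ) (p q α : ℝ) : ℝ :=
  mutualInfo (markovInput ℓ α) (channel p q) / ℓ

/-- The capacity `C_SI`, the maximum of `I(X;Y) / ℓ` over all laws of the input block. -/
def capacity (ℓ : ℕ) (p q : ℝ) : ℝ :=
  sSup ((fun P => mutualInfo P (channel p q)) '' stdSimplex ℝ (Fin ℓ → Bool)) / ℓ

/-- The supremum in the definition of the capacity is a maximum. -/
theorem exists_optimal_input (ℓ : ℕ) (p q : ℝ) :
    IsGreatest ((fun P => mutualInfo P (channel p q)) '' stdSimplex ℝ (Fin ℓ → Bool))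
      (sSup ((fun P => mutualInfo P (channel p q)) '' stdSimplex ℝ (Fin ℓ → Bool))) := by
  have hc : Continuous (fun P : (Fin ℓ → Bool) → ℝ => mutualInfo P (channel p q)) := by
    have h (f : ((Fin ℓ → Bool) → ℝ) → ℝ) (hf : Continuous f) :
        Continuous fun P => f P * Real.logb 2 (f P) := by
      simpa [Real.logb, mul_div_assoc] using
        ((Real.continuous_mul_log.comp hf).div_const (Real.log 2))
    unfold mutualInfo
    refine Continuous.sub ?_ (by fun_prop)
    unfold entropy
    exact (continuous_finsetSum _ fun y _ => h _ (by fun_prop)).neg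
  refine ((isCompact_stdSimplex ℝ (Fin ℓ → Bool)).image hc).isGreatest_sSup ?_
  exact ⟨_, Pi.single (fun _ => false) 1, single_mem_stdSimplex ℝ _, rfl⟩

/-- The runs of `x`: the pairs of first and last positions `(a, b)` of the maximal intervals on
which `x` is constant. -/
def runs {ℓ : ℕ} (x : Fin ℓ → Bool) : Finset (Fin ℓ × Fin ℓ) :=
  Finset.univ.filter fun s =>
    s.1 ≤ s.2 ∧ (∀ j, s.1 ≤ j → j ≤ s.2 → x j = x s.1) ∧
      (∀ j : Fin ℓ, (j : ℕ) + 1 = s.1 → x j ≠ x s.1) ∧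
      (∀ j : Fin ℓ, (j : ℕ) = s.2 + 1 → x j ≠ x s.1)

/-- The length of the interval of positions from `s.1` to `s.2`. -/
def runLength {ℓ : ℕ} (s : Fin ℓ × Fin ℓ) : ℕ := (s.2 : ℕ) + 1 - s.1

/-- The runlength empirical entropy of `x`, in bits. -/
def runEntropy {ℓ : ℕ} (x : Fin ℓ → Bool) : ℝ :=
  -∑ s ∈ runs x, (runLength s : ℝ) / ℓ * Real.logb 2 ((runLength s : ℝ) / ℓ)

/-- The analytical upper bound `U`. -/
def upperBound (ℓ : ℕ) (p q : ℝ) : ℝ :=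
  (p * ((ℓ : ℝ) - 1) + q * Real.logb 2 ((2 : ℝ) ^ (ℓ + 1) - 2)) / ℓ
    + (1 - p - q) * Real.logb 2
        (∑ x : Fin ℓ → Bool, (2 : ℝ) ^ (-((p + q) / (1 - p - q)) * runEntropy x)) / ℓ

/-- The constant `K = ∑_{j ≥ 1} j log₂ j / 2^(j+1)`, the sum being over `j = i + 1`, `i ≥ 0`. -/
def K : ℝ := ∑' i : ℕ, ((i : ℝ) + 1) * Real.logb 2 ((i : ℝ) + 1) / 2 ^ (i + 2)

/-- The common main part of the expansions. -/
def expansion (ℓ : ℕ) (p q : ℝ) : ℝ :=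
  1 - (p + q) / ℓ * Real.logb 2 ℓ + p / ℓ * (K - 1) + q / ℓ * (K + 1)

end

end OneBit

namespace OneBit

open Real

/-! The length of the output reveals which operation occurred, and two positions of `x` give the
same deleted (or duplicated) string exactly when they lie in one run. So, given `x` and the
operation, a deletion or duplication has entropy `runEntropy x`, and (`mutualInfo_channel`) I(X;Y) =
p H(deleted) + q H(duplicated) + (1-p-q) H(X) - (p+q) E[`runEntropy` X].

For uniform input the deleted string is uniform, and the duplicated string is so close to uniform
that its entropy loses at most 2/ℓ (`le_entropy_mixture_duplicateBit`). An interior interval of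
length r is a run with probability 2^(-r-1), so the mean of `runEntropy` is log ℓ - K + O(1/ℓ)
(`abs_meanRunEntropy_sub_le`). This gives (i).

For arbitrary input, the first two entropies are at most the log-cardinalities, and Gibbs'
inequality bounds the other two terms by (1-p-q) `logPartition` at s = (p+q)/(1-p-q). Testing Gibbs
on the uniform law bounds `logPartition` below by the linear expression ℓ - s E[`runEntropy`]; since
0 ≤ `runEntropy` ≤ log ℓ, a second-order estimate of the exponential bounds it above with an extra
s² log² ℓ (`logPartition_le`). This gives (ii), and the capacity is squeezed between this bound and
(i). -/

/-! ### Entropy and Gibbs' inequality -/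

theorem entropy_eq_sum_negMulLog {α : Type*} [Fintype α] (P : α → ℝ) :
    entropy P = (∑ a, negMulLog (P a)) / log 2 := by
  simp only [entropy, negMulLog, logb, Finset.sum_div, ← Finset.sum_neg_distrib]
  exact Finset.sum_congr rfl fun a _ => by ring

theorem entropy_const_mul {α : Type*} [Fintype α] (c : ℝ) (Q : α → ℝ) (hQ : ∑ a, Q a = 1) :
    entropy (fun a => c * Q a) = c * entropy Q - c * logb 2 c := by
  have h (a : α) : negMulLog (c * Q a) = Q a * negMulLog c + c * negMulLog (Q a) :=
    negMulLog_mul _ _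
  simp only [entropy_eq_sum_negMulLog, h, Finset.sum_add_distrib, ← Finset.sum_mul,
    ← Finset.mul_sum, hQ]
  simp only [logb, negMulLog]
  ring

theorem entropy_sum_type {α β : Type*} [Fintype α] [Fintype β] (P : α ⊕ β → ℝ) :
    entropy P = entropy (fun a => P (.inl a)) + entropy (fun b => P (.inr b)) := by
  simp only [entropy, Fintype.sum_sum_type]
  ring

theorem entropy_single {α : Type*} [Fintype α] [DecidableEq α] (a : α) :
    entropy (fun b => if a = b then (1 : ℝ) else 0) = 0 := by
  simp [entropy]

/-- Gibbs' inequality. -/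
theorem sum_mul_logb_add_entropy_le {α : Type*} [Fintype α] (P w : α → ℝ)
    (hP : P ∈ stdSimplex ℝ α) (hw : ∀ a, 0 < w a) :
    ∑ a, P a * logb 2 (w a) + entropy P ≤ logb 2 (∑ a, w a) := by
  obtain ⟨h0, h1⟩ := hP
  have hne : Nonempty α := by
    by_contra h
    rw [not_nonempty_iff] at h
    simp at h1
  set Z := ∑ a, w a
  have hZ : 0 < Z := Finset.sum_pos (fun a _ => hw a) Finset.univ_nonempty
  have hl : 0 < log 2 := log_pos one_lt_two
  have key (a : α) : P a * log (w a) - P a * log (P a) ≤ P a * log Z + w a / Z - P a := by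
    rcases (h0 a).eq_or_lt with h | h
    · rw [← h]
      simpa using (div_pos (hw a) hZ).le
    -- Here log z ≤ z - 1 is applied at z = w a / (P a * Z), the likelihood ratio of the Gibbs law
    -- to `P`.
    · have := log_le_sub_one_of_pos (div_pos (hw a) (mul_pos h hZ))
      rw [log_div (hw a).ne' (mul_pos h hZ).ne', log_mul h.ne' hZ.ne'] at this
      have h2 := mul_le_mul_of_nonneg_left this h.le
      have h3 : P a * (w a / (P a * Z) - 1) = w a / Z - P a := by
        field_simp
      linarith
  have hs := Finset.sum_le_sum fun a (_ : a ∈ Finset.univ) => key a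
  simp only [Finset.sum_sub_distrib, Finset.sum_add_distrib, ← Finset.sum_mul, ← Finset.sum_div,
    h1] at hs
  rw [div_self hZ.ne'] at hs
  simp only [entropy, logb, ← mul_div_assoc, ← Finset.sum_div]
  rw [← sub_eq_add_neg, ← sub_div]
  gcongr
  linarith

theorem entropy_le_logb_card {α : Type*} [Fintype α] (P : α → ℝ) (hP : P ∈ stdSimplex ℝ α) :
    entropy P ≤ logb 2 (Fintype.card α) := by
  simpa using sum_mul_logb_add_entropy_le P (fun _ => 1) hP fun _ => one_pos

theorem entropy_const {α : Type*} [Fintype α] (c : ℝ) (hc : Fintype.card α * c = 1) :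
    entropy (fun _ : α => c) = -logb 2 c := by
  simp [entropy, ← mul_assoc, hc]

/-! ### Decomposition of the mutual information -/

/-- The law of `f i` for `i` uniform. -/
noncomputable def hitLaw {ℓ : ℕ} {β : Type*} [DecidableEq β] (f : Fin ℓ → β) (y : β) : ℝ :=
  (Finset.univ.filter fun i => f i = y).card / ℓ

theorem hitLaw_nonneg {ℓ : ℕ} {β : Type*} [DecidableEq β] (f : Fin ℓ → β) (y : β) :
    0 ≤ hitLaw f y := by
  unfold hitLaw; positivity

theorem sum_hitLaw {ℓ : ℕ} (hℓ : 0 < ℓ) {β : Type*} [Fintype β] [DecidableEq β]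
    (f : Fin ℓ → β) : ∑ y, hitLaw f y = 1 := by
  have h := Finset.card_eq_sum_card_fiberwise (f := f) (s := Finset.univ) (t := Finset.univ)
    (fun _ _ => Finset.mem_univ _)
  simp only [hitLaw, ← Finset.sum_div]
  rw [← Nat.cast_sum, ← h]
  simp [hℓ.ne']

theorem entropy_hitLaw {ℓ : ℕ} {β : Type*} [Fintype β] [DecidableEq β] (f : Fin ℓ → β) :
    entropy (hitLaw f) =
      -∑ i, 1 / (ℓ : ℝ) * logb 2 ((Finset.univ.filter fun j => f j = f i).card / ℓ) := by
  rw [entropy, ← Finset.sum_fiberwise (s := Finset.univ) (g := f)]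
  congr 1
  refine Finset.sum_congr rfl fun y _ => ?_
  rw [Finset.sum_congr rfl (g := fun _ => 1 / (ℓ : ℝ) * logb 2 (hitLaw f y))]
  · simp [hitLaw]
    ring
  · intro i hi
    rw [Finset.mem_filter] at hi
    rw [hi.2, hitLaw]

theorem channel_inl {ℓ : ℕ} (p q : ℝ) (x : Fin ℓ → Bool) (y : Fin (ℓ - 1) → Bool) :
    channel p q x (.inl y) = p * hitLaw (deleteBit x) y := by
  simp [channel, hitLaw, ← Finset.sum_filter]
  ring

theorem channel_inr_inl {ℓ : ℕ} (p q : ℝ) (x y : Fin ℓ → Bool) :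
    channel p q x (.inr (.inl y)) = (1 - p - q) * if x = y then 1 else 0 := by
  simp [channel]

theorem channel_inr_inr {ℓ : ℕ} (p q : ℝ) (x : Fin ℓ → Bool) (y : Fin (ℓ + 1) → Bool) :
    channel p q x (.inr (.inr y)) = q * hitLaw (duplicateBit x) y := by
  simp [channel, hitLaw, ← Finset.sum_filter]
  ring

/-- The output law of a channel. -/
noncomputable def mixture {α β : Type*} [Fintype α] (P : α → ℝ) (W : α → β → ℝ) (y : β) : ℝ :=
  ∑ x, P x * W x y

theorem sum_mixture {α β : Type*} [Fintype α] [Fintype β] (P : α → ℝ) (W : α → β → ℝ)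
    (hP : ∑ x, P x = 1) (hW : ∀ x, ∑ y, W x y = 1) : ∑ y, mixture P W y = 1 := by
  simp only [mixture]
  rw [Finset.sum_comm]
  simp [← Finset.mul_sum, hW, hP]

theorem mixture_mem_stdSimplex {α β : Type*} [Fintype α] [Fintype β] (P : α → ℝ) (W : α → β → ℝ)
    (hP : P ∈ stdSimplex ℝ α) (hW : ∀ x, W x ∈ stdSimplex ℝ β) :
    mixture P W ∈ stdSimplex ℝ β :=
  ⟨fun y => Finset.sum_nonneg fun x _ => mul_nonneg (hP.1 x) ((hW x).1 y),
    sum_mixture P W hP.2 fun x => (hW x).2⟩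

theorem hitLaw_mem_stdSimplex {ℓ : ℕ} (hℓ : 0 < ℓ) {β : Type*} [Fintype β] [DecidableEq β]
    (f : Fin ℓ → β) : hitLaw f ∈ stdSimplex ℝ β :=
  ⟨hitLaw_nonneg f, sum_hitLaw hℓ f⟩

theorem entropy_channel {ℓ : ℕ} (hℓ : 0 < ℓ) (p q : ℝ) (x : Fin ℓ → Bool) :
    entropy (channel p q x) = p * entropy (hitLaw (deleteBit x)) +
      q * entropy (hitLaw (duplicateBit x)) -
      (p * logb 2 p + q * logb 2 q + (1 - p - q) * logb 2 (1 - p - q)) := by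
  rw [entropy_sum_type, entropy_sum_type]
  simp only [channel_inl, channel_inr_inl, channel_inr_inr]
  rw [entropy_const_mul _ _ (sum_hitLaw hℓ _), entropy_const_mul _ _ (sum_hitLaw hℓ _),
    entropy_const_mul _ _ (by simp), entropy_single]
  ring

/-- The three operations have disjoint output alphabets, so the entropy of the choice of operation
appears in both H(Y) and H(Y|X) and cancels. -/
theorem mutualInfo_channel {ℓ : ℕ} (hℓ : 0 < ℓ) (p q : ℝ) (P : (Fin ℓ → Bool) → ℝ)
    (hP : ∑ x, P x = 1) (h : (Fin ℓ → Bool) → ℝ)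
    (hdel : ∀ x : Fin ℓ → Bool, entropy (hitLaw (deleteBit x)) = h x)
    (hdup : ∀ x : Fin ℓ → Bool, entropy (hitLaw (duplicateBit x)) = h x) :
    mutualInfo P (channel p q) =
      p * entropy (mixture P fun x => hitLaw (deleteBit x)) +
      q * entropy (mixture P fun x => hitLaw (duplicateBit x)) +
      (1 - p - q) * entropy P - (p + q) * ∑ x, P x * h x := by
  have hc (c : ℝ) {β : Type} (W : (Fin ℓ → Bool) → β → ℝ) (y : β) :
      ∑ x, P x * (c * W x y) = c * mixture P W y := by
    rw [mixture, Finset.mul_sum]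
    exact Finset.sum_congr rfl fun x _ => by ring
  have hid : (mixture P fun x y => if x = y then (1 : ℝ) else 0) = P := by
    ext y
    simp [mixture]
  rw [mutualInfo, entropy_sum_type, entropy_sum_type]
  simp only [channel_inl, channel_inr_inl, channel_inr_inr]
  rw [funext fun y => hc p (fun x => hitLaw (deleteBit x)) y,
    funext fun y => hc q (fun x => hitLaw (duplicateBit x)) y,
    funext fun y => hc (1 - p - q) (fun x y => if x = y then (1 : ℝ) else 0) y, hid,
    entropy_const_mul _ _ (sum_mixture _ _ hP fun x => sum_hitLaw hℓ _),
    entropy_const_mul _ _ (sum_mixture _ _ hP fun x => sum_hitLaw hℓ _),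
    entropy_const_mul _ _ hP]
  simp only [entropy_channel hℓ, hdel, hdup, mul_sub, Finset.sum_sub_distrib, ← Finset.sum_mul,
    hP, ← add_mul]
  have : ∑ x, P x * ((p + q) * h x) = (p + q) * ∑ x, P x * h x := by
    rw [Finset.mul_sum]
    exact Finset.sum_congr rfl fun x _ => by ring
  rw [this]
  ring

/-! ### Runs and the conditional entropy -/

/-- The positions `i` and `j` lie in the same run of `x`. -/
def SameRun {ℓ : ℕ} (x : Fin ℓ → Bool) (i j : Fin ℓ) : Prop :=
  ∀ k, (i ≤ k ∧ k ≤ j ∨ j ≤ k ∧ k ≤ i) → x k = x i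

theorem SameRun.refl {ℓ : ℕ} (x : Fin ℓ → Bool) (i : Fin ℓ) : SameRun x i i := by
  intro k hk
  have : k = i := by omega
  rw [this]

theorem SameRun.symm {ℓ : ℕ} {x : Fin ℓ → Bool} {i j : Fin ℓ} (h : SameRun x i j) :
    SameRun x j i := by
  intro k hk
  rw [h k hk.symm, h j (by omega)]

theorem sameRun_of_adjacent {ℓ : ℕ} {x : Fin ℓ → Bool} {i j : Fin ℓ} (hij : i ≤ j)
    (h : ∀ (k : ℕ) (hk : k + 1 < ℓ), (i : ℕ) ≤ k → k < j → x ⟨k, by omega⟩ = x ⟨k + 1, hk⟩) :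
    SameRun x i j := by
  have key (n : ℕ) (hn : (i : ℕ) + n ≤ j) : x ⟨i + n, by omega⟩ = x i := by
    induction n with
    | zero => rfl
    | succ n ih => rw [← ih (by omega), h (i + n) (by omega) (by omega) (by omega)]; rfl
  intro k hk
  have := key (k - i) (by omega)
  rw [← this]
  congr 1
  ext
  simp only
  omega

/-- For i ≤ j the two strings can differ only at positions k with i ≤ k < j, where one shows `x (k +
1)` and the other `x k`. -/
theorem deleteBit_eq_iff {ℓ : ℕ} (x : Fin ℓ → Bool) (i j : Fin ℓ) :
    deleteBit x i = deleteBit x j ↔ SameRun x i j := by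
  wlog hij : i ≤ j generalizing i j
  · rw [eq_comm, this j i (by omega)]
    exact ⟨SameRun.symm, SameRun.symm⟩
  constructor
  · intro h
    refine sameRun_of_adjacent hij fun k hk h1 h2 => ?_
    have := congrFun h ⟨k, by omega⟩
    simp only [deleteBit] at this
    rw [if_neg (by omega), if_pos (by omega)] at this
    exact this.symm
  · intro h
    funext k
    simp only [deleteBit]
    split_ifs with h1 h2 h2
    · rfl
    · omega
    · rw [h ⟨k, by omega⟩ (by simp [Fin.le_def]; omega),
        h ⟨k + 1, by omega⟩ (by simp [Fin.le_def]; omega)]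
    · rfl

theorem duplicateBit_eq_iff {ℓ : ℕ} (x : Fin ℓ → Bool) (i j : Fin ℓ) :
    duplicateBit x i = duplicateBit x j ↔ SameRun x i j := by
  wlog hij : i ≤ j generalizing i j
  · rw [eq_comm, this j i (by omega)]
    exact ⟨SameRun.symm, SameRun.symm⟩
  constructor
  · intro h
    refine sameRun_of_adjacent hij fun k hk h1 h2 => ?_
    have := congrFun h ⟨k + 1, by omega⟩
    simp only [duplicateBit] at this
    rw [dif_neg (by omega), dif_pos (by omega)] at this
    exact this
  · intro h
    funext k
    simp only [duplicateBit]
    split_ifs with h1 h2 h2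
    · rfl
    · omega
    · rw [h ⟨k, by omega⟩ (by simp [Fin.le_def]; omega),
        h ⟨k - 1, by omega⟩ (by simp [Fin.le_def]; omega)]
    · rfl

theorem sameRun_iff_of_mem_runs {ℓ : ℕ} {x : Fin ℓ → Bool} {s : Fin ℓ × Fin ℓ}
    (hs : s ∈ runs x) {i : Fin ℓ} (hi : i ∈ Finset.Icc s.1 s.2) (j : Fin ℓ) :
    SameRun x i j ↔ j ∈ Finset.Icc s.1 s.2 := by
  simp only [runs, Finset.mem_filter, Finset.mem_univ, true_and, Finset.mem_Icc] at hs hi ⊢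
  obtain ⟨-, h2, h3, h4⟩ := hs
  constructor
  · intro h
    by_contra hj
    rcases lt_or_ge j s.1 with hlt | hge
    · refine h3 ⟨s.1 - 1, by omega⟩ (by simp only; omega) ?_
      rw [h _ (by simp [Fin.le_def]; omega), h2 i hi.1 hi.2]
    · have hlt : s.2 < j := by omega
      refine h4 ⟨s.2 + 1, by omega⟩ rfl ?_
      rw [h _ (by simp [Fin.le_def]; omega), h2 i hi.1 hi.2]
  · intro hj k hk
    rw [h2 k (by omega) (by omega), h2 i hi.1 hi.2]

theorem SameRun.trans {ℓ : ℕ} {x : Fin ℓ → Bool} {i j k : Fin ℓ} (h : SameRun x i j)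
    (h' : SameRun x j k) : SameRun x i k := by
  rw [← deleteBit_eq_iff] at *
  exact h.trans h'

theorem exists_mem_runs {ℓ : ℕ} (x : Fin ℓ → Bool) (i : Fin ℓ) :
    ∃ s ∈ runs x, i ∈ Finset.Icc s.1 s.2 := by
  classical
  have hne : (Finset.univ.filter fun j => SameRun x i j).Nonempty :=
    ⟨i, by simpa using SameRun.refl x i⟩
  obtain ⟨a, ha, hmin⟩ := Finset.exists_min_image _ id hne
  obtain ⟨b, hb, hmax⟩ := Finset.exists_max_image _ id hne
  simp only [Finset.mem_filter, Finset.mem_univ, true_and, id] at ha hmin hb hmax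
  have hai := hmin i (SameRun.refl x i)
  have hib := hmax i (SameRun.refl x i)
  have hab : SameRun x a b := ha.symm.trans hb
  refine ⟨(a, b), ?_, by simpa using ⟨hai, hib⟩⟩
  simp only [runs, Finset.mem_filter, Finset.mem_univ, true_and]
  refine ⟨hai.trans hib, fun j h1 h2 => hab j (.inl ⟨h1, h2⟩), fun j hj hx => ?_,
    fun j hj hx => ?_⟩
  · have : SameRun x a j := by
      intro k hk
      rcases (show k = j ∨ k = a by omega) with rfl | rfl
      · exact hx
      · rfl
    have := hmin j (ha.trans this)
    omega
  · have : SameRun x b j := by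
      intro k hk
      rcases (show k = j ∨ k = b by omega) with rfl | rfl
      · rw [hx, hab b (.inl ⟨hai.trans hib, le_rfl⟩)]
      · rfl
    have := hmax j (hb.trans this)
    omega

theorem card_runs_filter_mem {ℓ : ℕ} (x : Fin ℓ → Bool) (i : Fin ℓ) :
    ((runs x).filter fun s => i ∈ Finset.Icc s.1 s.2).card = 1 := by
  rw [Finset.card_eq_one]
  obtain ⟨s, hs, hi⟩ := exists_mem_runs x i
  refine ⟨s, ?_⟩
  ext t
  rw [Finset.mem_filter, Finset.mem_singleton]
  refine ⟨fun ⟨ht, hit⟩ => ?_, fun h => h ▸ ⟨hs, hi⟩⟩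
  have h (j : Fin ℓ) : j ∈ Finset.Icc s.1 s.2 ↔ j ∈ Finset.Icc t.1 t.2 := by
    rw [← sameRun_iff_of_mem_runs hs hi, ← sameRun_iff_of_mem_runs ht hit]
  have hs1 : s.1 ≤ s.2 := by simp only [Finset.mem_Icc] at hi; omega
  have ht1 : t.1 ≤ t.2 := by simp only [Finset.mem_Icc] at hit; omega
  simp only [Finset.mem_Icc] at h
  have e1 := h s.1
  have e2 := h s.2
  have e3 := h t.1
  have e4 := h t.2
  ext <;> omega

theorem card_Icc_eq_runLength {ℓ : ℕ} (s : Fin ℓ × Fin ℓ) :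
    (Finset.Icc s.1 s.2).card = runLength s := by
  simp [runLength]

/-- Double counting: the runs partition the positions, and each position of a run of length r
contributes F r. This links the run-indexed `runEntropy` to the position-indexed `entropy_hitLaw`.
-/
theorem sum_runs {ℓ : ℕ} (x : Fin ℓ → Bool) (F : ℕ → ℝ) [DecidableRel (SameRun x)] :
    ∑ s ∈ runs x, (runLength s : ℝ) * F (runLength s) =
      ∑ i, F (Finset.univ.filter fun j => SameRun x i j).card := by
  have h1 (s : Fin ℓ × Fin ℓ) (hs : s ∈ runs x) : (runLength s : ℝ) * F (runLength s) =
      ∑ i ∈ Finset.Icc s.1 s.2, F (Finset.univ.filter fun j => SameRun x i j).card := by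
    rw [← card_Icc_eq_runLength, ← nsmul_eq_mul, ← Finset.sum_const]
    refine Finset.sum_congr rfl fun i hi => ?_
    congr 2
    ext j
    simp [sameRun_iff_of_mem_runs hs hi]
  rw [Finset.sum_congr rfl h1, Finset.sum_comm' (t' := Finset.univ)
    (s' := fun i => (runs x).filter fun s => i ∈ Finset.Icc s.1 s.2)]
  · simp only [Finset.sum_const, card_runs_filter_mem, one_smul]
  · intro s i
    simp

theorem entropy_hitLaw_eq_runEntropy {ℓ : ℕ} {β : Type*} [Fintype β] [DecidableEq β]
    (x : Fin ℓ → Bool) (f : Fin ℓ → β) (hf : ∀ i j, f i = f j ↔ SameRun x i j) :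
    entropy (hitLaw f) = runEntropy x := by
  classical
  rw [entropy_hitLaw, runEntropy]
  congr 1
  have := sum_runs x fun n => 1 / (ℓ : ℝ) * logb 2 (n / ℓ)
  rw [Finset.sum_congr rfl fun s _ => show (runLength s : ℝ) / ℓ * logb 2 (runLength s / ℓ) =
    runLength s * (1 / (ℓ : ℝ) * logb 2 (runLength s / ℓ)) by ring, this]
  refine Finset.sum_congr rfl fun i _ => ?_
  congr 6
  ext j
  rw [eq_comm, hf]

theorem entropy_hitLaw_deleteBit {ℓ : ℕ} (x : Fin ℓ → Bool) :
    entropy (hitLaw (deleteBit x)) = runEntropy x :=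
  entropy_hitLaw_eq_runEntropy x _ (deleteBit_eq_iff x)

theorem entropy_hitLaw_duplicateBit {ℓ : ℕ} (x : Fin ℓ → Bool) :
    entropy (hitLaw (duplicateBit x)) = runEntropy x :=
  entropy_hitLaw_eq_runEntropy x _ (duplicateBit_eq_iff x)

theorem sum_runLength {ℓ : ℕ} (x : Fin ℓ → Bool) :
    ∑ s ∈ runs x, (runLength s : ℝ) = ℓ := by
  classical
  simpa using sum_runs x fun _ => 1

theorem runLength_pos {ℓ : ℕ} {x : Fin ℓ → Bool} {s : Fin ℓ × Fin ℓ} (hs : s ∈ runs x) :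
    0 < runLength s := by
  simp only [runs, Finset.mem_filter] at hs
  unfold runLength
  omega

theorem runLength_le {ℓ : ℕ} (s : Fin ℓ × Fin ℓ) : runLength s ≤ ℓ := by
  unfold runLength
  omega

theorem runEntropy_eq {ℓ : ℕ} (hℓ : 0 < ℓ) (x : Fin ℓ → Bool) :
    runEntropy x =
      logb 2 ℓ - (∑ s ∈ runs x, (runLength s : ℝ) * logb 2 (runLength s)) / ℓ := by
  have hℓ' : (ℓ : ℝ) ≠ 0 := by positivity
  have h (s) (hs : s ∈ runs x) : (runLength s : ℝ) / ℓ * logb 2 (runLength s / ℓ) =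
      runLength s * logb 2 (runLength s) / ℓ - runLength s * (logb 2 ℓ / ℓ) := by
    have := runLength_pos hs
    rw [logb_div (by positivity) hℓ']
    ring
  rw [runEntropy, Finset.sum_congr rfl h, Finset.sum_sub_distrib, ← Finset.sum_mul,
    sum_runLength, Finset.sum_div]
  field_simp
  ring

theorem runEntropy_le {ℓ : ℕ} (hℓ : 0 < ℓ) (x : Fin ℓ → Bool) : runEntropy x ≤ logb 2 ℓ := by
  rw [runEntropy_eq hℓ]
  refine sub_le_self _ (div_nonneg (Finset.sum_nonneg fun s hs => ?_) (by positivity))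
  have : (1 : ℝ) ≤ runLength s := by exact_mod_cast runLength_pos hs
  exact mul_nonneg (by positivity) (logb_nonneg one_lt_two this)

theorem runEntropy_nonneg {ℓ : ℕ} (x : Fin ℓ → Bool) : 0 ≤ runEntropy x := by
  rw [runEntropy, neg_nonneg]
  refine Finset.sum_nonpos fun s hs => ?_
  refine mul_nonpos_of_nonneg_of_nonpos (by positivity) (logb_nonpos one_lt_two (by positivity) ?_)
  exact div_le_one_of_le₀ (by exact_mod_cast runLength_le s) (by positivity)

/-! ### The constant K -/

/-- The terms of the series `K`. -/
noncomputable def seriesTerm (i : ℕ) : ℝ := ((i : ℝ) + 1) * logb 2 ((i : ℝ) + 1) / 2 ^ (i + 2)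

/-- A bound for the tail of the series `K` from the index `n` on. -/
noncomputable def tailBound (n : ℕ) : ℝ := ((n : ℝ) ^ 2 + 3 * n + 4) / 2 ^ (n + 1)

theorem seriesTerm_nonneg (i : ℕ) : 0 ≤ seriesTerm i := by
  have : 0 ≤ logb 2 ((i : ℝ) + 1) := logb_nonneg one_lt_two (by linarith [i.cast_nonneg (α := ℝ)])
  unfold seriesTerm
  positivity

theorem logb_two_add_one_le (i : ℕ) : logb 2 ((i : ℝ) + 1) ≤ i := by
  rw [logb_le_iff_le_rpow one_lt_two (by positivity), rpow_natCast]
  exact_mod_cast i.lt_two_pow_self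

/-- Replacing the logarithm by i leaves i(i+1)/2^(i+2), which telescopes exactly along `tailBound`.
-/
theorem seriesTerm_le (i : ℕ) : seriesTerm i ≤ tailBound i - tailBound (i + 1) := by
  have h : tailBound i - tailBound (i + 1) = ((i : ℝ) + 1) * i / 2 ^ (i + 2) := by
    unfold tailBound
    push_cast
    field_simp
    ring
  rw [h, seriesTerm]
  gcongr
  exact logb_two_add_one_le i

theorem tailBound_nonneg (n : ℕ) : 0 ≤ tailBound n := by
  unfold tailBound
  positivity

theorem sum_seriesTerm_add_tailBound_le {m n : ℕ} (h : m ≤ n) :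
    ∑ i ∈ Finset.range n, seriesTerm i + tailBound n ≤
      ∑ i ∈ Finset.range m, seriesTerm i + tailBound m := by
  induction n, h using Nat.le_induction with
  | base => rfl
  | succ n _ ih =>
    rw [Finset.sum_range_succ]
    linarith [seriesTerm_le n]

theorem sum_range_seriesTerm_le (m n : ℕ) :
    ∑ i ∈ Finset.range n, seriesTerm i ≤ ∑ i ∈ Finset.range m, seriesTerm i + tailBound m := by
  rcases le_total m n with h | h
  · linarith [sum_seriesTerm_add_tailBound_le h, tailBound_nonneg n]
  · have := Finset.sum_le_sum_of_subset_of_nonneg (Finset.range_mono h)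
      fun i _ _ => seriesTerm_nonneg i
    linarith [tailBound_nonneg m]

theorem summable_seriesTerm : Summable seriesTerm :=
  summable_of_sum_range_le seriesTerm_nonneg (sum_range_seriesTerm_le 0)

theorem sum_seriesTerm_le_K (n : ℕ) : ∑ i ∈ Finset.range n, seriesTerm i ≤ K :=
  summable_seriesTerm.sum_le_tsum _ fun i _ => seriesTerm_nonneg i

theorem K_le_sum_seriesTerm_add_tailBound (n : ℕ) :
    K ≤ ∑ i ∈ Finset.range n, seriesTerm i + tailBound n :=
  Real.tsum_le_of_sum_range_le seriesTerm_nonneg (sum_range_seriesTerm_le n)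

theorem le_logb_two_of_pow_le {n a b : ℕ} (hb : 0 < b) (hn : 0 < n) (h : 2 ^ a ≤ n ^ b) :
    (a : ℝ) / b ≤ logb 2 n := by
  rw [div_le_iff₀ (by positivity), mul_comm, ← logb_pow,
    le_logb_iff_rpow_le one_lt_two (by positivity), rpow_natCast]
  exact_mod_cast h

theorem logb_two_le_of_le_pow {n a b : ℕ} (hb : 0 < b) (hn : 0 < n) (h : n ^ b ≤ 2 ^ a) :
    logb 2 n ≤ (a : ℝ) / b := by
  rw [le_div_iff₀ (by positivity), mul_comm, ← logb_pow,
    logb_le_iff_le_rpow one_lt_two (by positivity), rpow_natCast]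
  exact_mod_cast h

theorem logb_two_two_mul {x : ℝ} (hx : 0 < x) : logb 2 (2 * x) = 1 + logb 2 x := by
  rw [logb_mul two_ne_zero hx.ne', logb_self_eq_one one_lt_two]

set_option exponentiation.threshold 2000 in
theorem abs_K_sub_lt : |K - 1.2885| < 0.00005 := by
  -- After 28 terms the tail bound is below 2·10⁻⁶.
  have lower := sum_seriesTerm_le_K 28
  have upper := K_le_sum_seriesTerm_add_tailBound 28
  simp only [Finset.sum_range_succ, Finset.sum_range_zero, seriesTerm, tailBound] at lower upper
  norm_num at lower upper
  -- Rational bounds for the logarithms of odd numbers, certified by comparing integer powers. They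
  -- may be coarser for large n, whose weight is n/2^(n+1). Even numbers reduce to these by halving.
  have l3 := le_logb_two_of_pow_le (n := 3) (a := 569) (b := 359) (by norm_num) (by norm_num) (by norm_num)
  have u3 := logb_two_le_of_le_pow (n := 3) (a := 485) (b := 306) (by norm_num) (by norm_num) (by norm_num)
  have l5 := le_logb_two_of_pow_le (n := 5) (a := 339) (b := 146) (by norm_num) (by norm_num) (by norm_num)
  have u5 := logb_two_le_of_le_pow (n := 5) (a := 815) (b := 351) (by norm_num) (by norm_num) (by norm_num)
  have l7 := le_logb_two_of_pow_le (n := 7) (a := 306) (b := 109) (by norm_num) (by norm_num) (by norm_num)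
  have u7 := logb_two_le_of_le_pow (n := 7) (a := 685) (b := 244) (by norm_num) (by norm_num) (by norm_num)
  have l9 := le_logb_two_of_pow_le (n := 9) (a := 168) (b := 53) (by norm_num) (by norm_num) (by norm_num)
  have u9 := logb_two_le_of_le_pow (n := 9) (a := 317) (b := 100) (by norm_num) (by norm_num) (by norm_num)
  have l11 := le_logb_two_of_pow_le (n := 11) (a := 83) (b := 24) (by norm_num) (by norm_num) (by norm_num)
  have u11 := logb_two_le_of_le_pow (n := 11) (a := 128) (b := 37) (by norm_num) (by norm_num) (by norm_num)
  have l13 := le_logb_two_of_pow_le (n := 13) (a := 37) (b := 10) (by norm_num) (by norm_num) (by norm_num)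
  have u13 := logb_two_le_of_le_pow (n := 13) (a := 211) (b := 57) (by norm_num) (by norm_num) (by norm_num)
  have l15 := le_logb_two_of_pow_le (n := 15) (a := 39) (b := 10) (by norm_num) (by norm_num) (by norm_num)
  have u15 := logb_two_le_of_le_pow (n := 15) (a := 43) (b := 11) (by norm_num) (by norm_num) (by norm_num)
  have l17 := le_logb_two_of_pow_le (n := 17) (a := 49) (b := 12) (by norm_num) (by norm_num) (by norm_num)
  have u17 := logb_two_le_of_le_pow (n := 17) (a := 45) (b := 11) (by norm_num) (by norm_num) (by norm_num)
  have l19 := le_logb_two_of_pow_le (n := 19) (a := 4) (b := 1) (by norm_num) (by norm_num) (by norm_num)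
  have u19 := logb_two_le_of_le_pow (n := 19) (a := 17) (b := 4) (by norm_num) (by norm_num) (by norm_num)
  have l21 := le_logb_two_of_pow_le (n := 21) (a := 4) (b := 1) (by norm_num) (by norm_num) (by norm_num)
  have u21 := logb_two_le_of_le_pow (n := 21) (a := 9) (b := 2) (by norm_num) (by norm_num) (by norm_num)
  have l23 := le_logb_two_of_pow_le (n := 23) (a := 4) (b := 1) (by norm_num) (by norm_num) (by norm_num)
  have u23 := logb_two_le_of_le_pow (n := 23) (a := 5) (b := 1) (by norm_num) (by norm_num) (by norm_num)
  have l25 := le_logb_two_of_pow_le (n := 25) (a := 4) (b := 1) (by norm_num) (by norm_num) (by norm_num)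
  have u25 := logb_two_le_of_le_pow (n := 25) (a := 5) (b := 1) (by norm_num) (by norm_num) (by norm_num)
  have l27 := le_logb_two_of_pow_le (n := 27) (a := 4) (b := 1) (by norm_num) (by norm_num) (by norm_num)
  have u27 := logb_two_le_of_le_pow (n := 27) (a := 5) (b := 1) (by norm_num) (by norm_num) (by norm_num)
  have e2 : logb 2 (2 : ℝ) = 1 := logb_self_eq_one one_lt_two
  have e4 : logb 2 (4 : ℝ) = 1 + logb 2 2 := by
    rw [← logb_two_two_mul (by norm_num)]; norm_num
  have e6 : logb 2 (6 : ℝ) = 1 + logb 2 3 := by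
    rw [← logb_two_two_mul (by norm_num)]; norm_num
  have e8 : logb 2 (8 : ℝ) = 1 + logb 2 4 := by
    rw [← logb_two_two_mul (by norm_num)]; norm_num
  have e10 : logb 2 (10 : ℝ) = 1 + logb 2 5 := by
    rw [← logb_two_two_mul (by norm_num)]; norm_num
  have e12 : logb 2 (12 : ℝ) = 1 + logb 2 6 := by
    rw [← logb_two_two_mul (by norm_num)]; norm_num
  have e14 : logb 2 (14 : ℝ) = 1 + logb 2 7 := by
    rw [← logb_two_two_mul (by norm_num)]; norm_num
  have e16 : logb 2 (16 : ℝ) = 1 + logb 2 8 := by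
    rw [← logb_two_two_mul (by norm_num)]; norm_num
  have e18 : logb 2 (18 : ℝ) = 1 + logb 2 9 := by
    rw [← logb_two_two_mul (by norm_num)]; norm_num
  have e20 : logb 2 (20 : ℝ) = 1 + logb 2 10 := by
    rw [← logb_two_two_mul (by norm_num)]; norm_num
  have e22 : logb 2 (22 : ℝ) = 1 + logb 2 11 := by
    rw [← logb_two_two_mul (by norm_num)]; norm_num
  have e24 : logb 2 (24 : ℝ) = 1 + logb 2 12 := by
    rw [← logb_two_two_mul (by norm_num)]; norm_num
  have e26 : logb 2 (26 : ℝ) = 1 + logb 2 13 := by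
    rw [← logb_two_two_mul (by norm_num)]; norm_num
  have e28 : logb 2 (28 : ℝ) = 1 + logb 2 14 := by
    rw [← logb_two_two_mul (by norm_num)]; norm_num
  push_cast at l3 u3 l5 u5 l7 u7 l9 u9 l11 u11 l13 u13 l15 u15 l17 u17 l19 u19 l21 u21 l23 u23 l25 u25 l27 u27
  rw [abs_lt]
  constructor <;> linarith

/-! ### Output laws for the uniform input -/

theorem card_filter_forall_mem_eq {ℓ : ℕ} (S : Finset (Fin ℓ)) (v : Fin ℓ → Bool) :
    (Finset.univ.filter fun x : Fin ℓ → Bool => ∀ j ∈ S, x j = v j).card = 2 ^ (ℓ - S.card) := by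
  have h : (Finset.univ.filter fun x : Fin ℓ → Bool => ∀ j ∈ S, x j = v j) =
      Fintype.piFinset fun j => if j ∈ S then {v j} else Finset.univ := by
    ext x
    simp only [Finset.mem_filter, Finset.mem_univ, true_and, Fintype.mem_piFinset]
    refine forall_congr' fun j => ?_
    split_ifs with hj <;> simp [hj]
  rw [h, Fintype.card_piFinset]
  have h2 (j : Fin ℓ) : (if j ∈ S then ({v j} : Finset Bool) else Finset.univ).card =
      if j ∈ S then 1 else 2 := by
    split_ifs <;> simp
  simp only [h2, Finset.prod_ite, Finset.prod_const, one_pow, one_mul]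
  congr 1
  rw [Finset.filter_not, Finset.card_sdiff_of_subset (Finset.filter_subset _ _)]
  simp

theorem card_filter_deleteBit_eq {ℓ : ℕ} (i : Fin ℓ) (y : Fin (ℓ - 1) → Bool) :
    (Finset.univ.filter fun x : Fin ℓ → Bool => deleteBit x i = y).card = 2 := by
  have hi := i.isLt
  -- All bits but the deleted one are forced by `y`. The fallback `false` is reached only at j = i,
  -- which is erased.
  have h := card_filter_forall_mem_eq (Finset.univ.erase i) fun j =>
    if h : (j : ℕ) < i then y ⟨j, by omega⟩ else
      if h' : (j : ℕ) - 1 < ℓ - 1 then y ⟨j - 1, h'⟩ else false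
  rw [Finset.card_erase_of_mem (Finset.mem_univ i), Finset.card_univ, Fintype.card_fin,
    show ℓ - (ℓ - 1) = 1 by omega, pow_one] at h
  rw [← h]
  congr 1
  ext x
  simp only [Finset.mem_filter, Finset.mem_univ, true_and, Finset.mem_erase, and_true]
  constructor
  · rintro rfl j hj
    have hj' : (j : ℕ) ≠ i := fun e => hj (Fin.ext e)
    by_cases h1 : (j : ℕ) < i
    · simp [h1, deleteBit]
    · have h2 : ¬ (j : ℕ) - 1 < i := by omega
      have h3 : (j : ℕ) - 1 < ℓ - 1 := by omega
      simp only [h1, h2, h3, deleteBit, dif_pos, dif_neg, not_false_eq_true, if_false]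
      congr 1
      ext
      simp only
      omega
  · intro hx
    funext k
    simp only [deleteBit]
    split_ifs with h1
    · rw [hx _ (by intro e; simp [← e] at h1)]
      simp [h1]
    · rw [hx _ (by intro e; simp [← e] at h1)]
      have h2 : ¬ (k : ℕ) + 1 < i := by omega
      simp [h2]

theorem card_filter_duplicateBit_eq {ℓ : ℕ} (i : Fin ℓ) (y : Fin (ℓ + 1) → Bool) :
    (Finset.univ.filter fun x : Fin ℓ → Bool => duplicateBit x i = y).card =
      if y i.castSucc = y i.succ then 1 else 0 := by
  split_ifs with h
  · rw [Finset.card_eq_one]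
    refine ⟨fun j => if j ≤ i then y j.castSucc else y j.succ, ?_⟩
    ext x
    simp only [Finset.mem_filter, Finset.mem_univ, true_and, Finset.mem_singleton]
    constructor
    · rintro rfl
      funext j
      by_cases hj : j ≤ i
      · simp [hj, duplicateBit]
      · have h2 : ¬ (j : ℕ) + 1 ≤ i := by omega
        simp [hj, duplicateBit, h2]
    · rintro rfl
      funext k
      simp only [duplicateBit]
      split_ifs with h1 h2 h3
      · rfl
      · exact absurd h1 h2
      · have : (k : ℕ) = i + 1 := by simp [Fin.le_def] at h3; omega
        have hk : k = i.succ := Fin.ext (by simpa using this)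
        have hk' : (⟨(k : ℕ) - 1, by omega⟩ : Fin ℓ) = i := Fin.ext (by simp only; omega)
        rw [show y k = y i.castSucc by rw [hk, h]]
        exact congrArg (fun j : Fin ℓ => y j.castSucc) hk'
      · congr 1
        ext
        simp [Fin.le_def] at h3 ⊢
        omega
  · rw [Finset.card_eq_zero, Finset.filter_eq_empty_iff]
    rintro x - rfl
    apply h
    simp [duplicateBit]

theorem mixture_const_hitLaw {ℓ : ℕ} {α β : Type*} [Fintype α] [DecidableEq β] (c : ℝ)
    (f : α → Fin ℓ → β) (y : β) :
    mixture (fun _ => c) (fun x => hitLaw (f x)) y =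
      c / ℓ * ∑ i, ((Finset.univ.filter fun x => f x i = y).card : ℝ) := by
  simp only [mixture, hitLaw, Finset.card_eq_sum_ones, Finset.sum_filter, Nat.cast_sum,
    ← mul_div_assoc, ← Finset.sum_div, ← Finset.mul_sum]
  rw [Finset.sum_comm, mul_div_right_comm]

theorem mixture_const_hitLaw_deleteBit {ℓ : ℕ} (hℓ : 0 < ℓ) (y : Fin (ℓ - 1) → Bool) :
    mixture (fun _ : Fin ℓ → Bool => ((1 : ℝ) / 2) ^ ℓ) (fun x => hitLaw (deleteBit x)) y =
      (1 / 2) ^ (ℓ - 1) := by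
  rw [mixture_const_hitLaw]
  simp only [card_filter_deleteBit_eq]
  obtain ⟨n, rfl⟩ := Nat.exists_eq_add_of_lt hℓ
  simp
  field_simp
  ring

theorem entropy_mixture_deleteBit {ℓ : ℕ} (hℓ : 0 < ℓ) :
    entropy (mixture (fun _ : Fin ℓ → Bool => ((1 : ℝ) / 2) ^ ℓ) fun x => hitLaw (deleteBit x)) =
      ℓ - 1 := by
  rw [funext fun y => mixture_const_hitLaw_deleteBit hℓ y, entropy_const, logb_pow, one_div,
    logb_inv, logb_self_eq_one one_lt_two, Nat.cast_sub hℓ]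
  · simp
  · simp 

/-- The sign `1` or `-1` according to whether bits `i` and `i + 1` of `y` agree. -/
def agreement {ℓ : ℕ} (i : Fin ℓ) (y : Fin (ℓ + 1) → Bool) : ℝ :=
  if y i.castSucc = y i.succ then 1 else -1

/-- The string `y` with its bits up to position `i` flipped. -/
def flipUpTo {ℓ : ℕ} (i : Fin ℓ) (y : Fin (ℓ + 1) → Bool) : Fin (ℓ + 1) → Bool := fun j =>
  if j ≤ i.castSucc then !y j else y j

theorem flipUpTo_involutive {ℓ : ℕ} (i : Fin ℓ) : Function.Involutive (flipUpTo i) := by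
  intro y
  funext j
  simp only [flipUpTo]
  split_ifs <;> simp

theorem agreement_flipUpTo_self {ℓ : ℕ} (i : Fin ℓ) (y : Fin (ℓ + 1) → Bool) :
    agreement i (flipUpTo i y) = -agreement i y := by
  have h : ¬ i.succ ≤ i.castSucc := by simp
  simp only [agreement, flipUpTo, le_refl, if_true, h, if_false]
  cases y i.castSucc <;> cases y i.succ <;> simp

theorem agreement_flipUpTo_of_ne {ℓ : ℕ} {i k : Fin ℓ} (hik : i ≠ k) (y : Fin (ℓ + 1) → Bool) :
    agreement k (flipUpTo i y) = agreement k y := by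
  rcases lt_or_gt_of_ne hik with h | h
  · have h1 : ¬ k.castSucc ≤ i.castSucc := fun h' => absurd h (not_lt.2 h')
    have h2 : ¬ k.succ ≤ i.castSucc := fun h' => absurd h (not_lt.2 (Fin.le_of_lt h'))
    simp [agreement, flipUpTo, h1, h2]
  · have h1 : k.castSucc ≤ i.castSucc := Fin.le_of_lt h
    have h2 : k.succ ≤ i.castSucc := h
    simp only [agreement, flipUpTo, h1, h2, if_true]
    cases y k.castSucc <;> cases y k.succ <;> simp

theorem sum_eq_zero_of_flipUpTo {ℓ : ℕ} (i : Fin ℓ) (F : (Fin (ℓ + 1) → Bool) → ℝ)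
    (h : ∀ y, F (flipUpTo i y) = -F y) : ∑ y, F y = 0 := by
  have := Equiv.sum_comp (flipUpTo_involutive i).toPerm F
  simp only [Function.Involutive.coe_toPerm, h, Finset.sum_neg_distrib] at this
  linarith

theorem sum_agreement {ℓ : ℕ} (i : Fin ℓ) : ∑ y, agreement i y = 0 :=
  sum_eq_zero_of_flipUpTo i _ (agreement_flipUpTo_self i)

/-- The agreements are pairwise orthogonal: flipping the prefix that ends at i negates `agreement i`
and fixes the others, so only the diagonal terms survive. -/
theorem sum_sq_sum_agreement (ℓ : ℕ) :
    ∑ y : Fin (ℓ + 1) → Bool, (∑ i, agreement i y) ^ 2 = ℓ * 2 ^ (ℓ + 1) := by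
  have h (i k : Fin ℓ) : ∑ y, agreement i y * agreement k y =
      if i = k then (2 : ℝ) ^ (ℓ + 1) else 0 := by
    split_ifs with hik
    · subst hik
      have (y : Fin (ℓ + 1) → Bool) : agreement i y * agreement i y = 1 := by
        unfold agreement
        split_ifs <;> norm_num
      simp [this]
    · refine sum_eq_zero_of_flipUpTo i _ fun y => ?_
      rw [agreement_flipUpTo_self, agreement_flipUpTo_of_ne hik, neg_mul]
  simp only [sq, Finset.sum_mul_sum]
  rw [Finset.sum_comm]
  simp only [Finset.sum_comm (s := (Finset.univ : Finset (Fin (ℓ + 1) → Bool))), h]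
  simp

/-- A chi-square bound on the divergence from uniform: log(1 + v) ≤ v, and the mean of v under `P`
is the uniform mean of v² because v has uniform mean zero. -/
theorem logb_card_sub_le_entropy {α : Type*} [Fintype α] [Nonempty α] (P v : α → ℝ)
    (hP : ∀ a, P a = 1 / (Fintype.card α : ℝ) * (1 + v a)) (hP0 : ∀ a, 0 ≤ P a)
    (hv : ∑ a, v a = 0) :
    logb 2 (Fintype.card α) - (∑ a, v a ^ 2) / Fintype.card α / log 2 ≤ entropy P := by
  set N : ℝ := (Fintype.card α : ℝ) with hNdef
  have hN : 0 < N := by rw [hNdef]; exact_mod_cast Fintype.card_pos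
  have hl : 0 < log 2 := log_pos one_lt_two
  have key (a : α) : P a * logb 2 (P a) ≤ -(P a * logb 2 N) + P a * v a / log 2 := by
    rcases (hP0 a).eq_or_lt with h | h
    · simp [← h]
    · have h1 : 0 < 1 + v a := by
        rw [hP] at h
        exact (pos_iff_pos_of_mul_pos h).1 (by positivity)
      have h2 : logb 2 (P a) ≤ -logb 2 N + v a / log 2 := by
        rw [hP, logb_mul (by positivity) h1.ne', one_div, logb_inv, ← log_div_log (x := 1 + v a)]
        gcongr
        linarith [log_le_sub_one_of_pos h1]
      calc _ ≤ P a * (-logb 2 N + v a / log 2) := by gcongr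
        _ = _ := by ring
  have hsum : ∑ a, P a = 1 := by
    simp only [hP, ← Finset.mul_sum, Finset.sum_add_distrib, hv]
    simp [← hNdef, hN.ne']
  have hPv : ∑ a, P a * v a = (∑ a, v a ^ 2) / N := by
    rw [Finset.sum_congr rfl fun a _ => show P a * v a = v a / N + v a ^ 2 / N by rw [hP]; ring,
      Finset.sum_add_distrib, ← Finset.sum_div, hv, Finset.sum_div]
    simp
  have := Finset.sum_le_sum fun a (_ : a ∈ Finset.univ) => key a
  rw [Finset.sum_add_distrib, Finset.sum_neg_distrib, ← Finset.sum_mul, ← Finset.sum_div, hsum,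
    hPv] at this
  rw [entropy]
  linarith

theorem mixture_const_hitLaw_duplicateBit {ℓ : ℕ} (hℓ : 0 < ℓ) (y : Fin (ℓ + 1) → Bool) :
    mixture (fun _ : Fin ℓ → Bool => ((1 : ℝ) / 2) ^ ℓ) (fun x => hitLaw (duplicateBit x)) y =
      1 / (Fintype.card (Fin (ℓ + 1) → Bool) : ℝ) * (1 + (∑ i, agreement i y) / ℓ) := by
  rw [mixture_const_hitLaw]
  have h (i : Fin ℓ) : ((Finset.univ.filter fun x : Fin ℓ → Bool =>
      duplicateBit x i = y).card : ℝ) = (1 + agreement i y) / 2 := by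
    rw [card_filter_duplicateBit_eq, agreement]
    split_ifs <;> norm_num
  simp only [h, ← Finset.sum_div, Finset.sum_add_distrib]
  simp
  field_simp
  ring

theorem one_div_log_two_le : 1 / log 2 ≤ 2 := by
  rw [div_le_iff₀ (log_pos one_lt_two)]
  linarith [log_two_gt_d9]

theorem le_entropy_mixture_duplicateBit {ℓ : ℕ} (hℓ : 0 < ℓ) :
    (ℓ : ℝ) + 1 - 2 / ℓ ≤ entropy
      (mixture (fun _ : Fin ℓ → Bool => ((1 : ℝ) / 2) ^ ℓ) fun x => hitLaw (duplicateBit x)) := by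
  have h := logb_card_sub_le_entropy _ (fun y => (∑ i, agreement i y) / ℓ)
    (mixture_const_hitLaw_duplicateBit hℓ)
    (fun y => Finset.sum_nonneg fun x _ => mul_nonneg (by positivity) (hitLaw_nonneg _ _))
    (by rw [← Finset.sum_div, Finset.sum_comm]; simp [sum_agreement])
  refine le_trans ?_ h
  simp only [div_pow, ← Finset.sum_div, sum_sq_sum_agreement]
  simp only [Fintype.card_pi, Fintype.card_bool, Finset.prod_const, Finset.card_univ,
    Fintype.card_fin, Nat.cast_pow, Nat.cast_ofNat]
  rw [logb_pow, logb_self_eq_one one_lt_two]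
  -- The relative deviation from uniform has mean square 1/ℓ.
  have : (ℓ : ℝ) * 2 ^ (ℓ + 1) / ℓ ^ 2 / 2 ^ (ℓ + 1) / log 2 = 1 / ℓ * (1 / log 2) := by
    field_simp
  rw [this]
  have h2 : 1 / (ℓ : ℝ) * (1 / log 2) ≤ 1 / ℓ * 2 := by
    gcongr
    exact one_div_log_two_le
  push_cast
  linarith [show 1 / (ℓ : ℝ) * 2 = 2 / ℓ by ring]

theorem markovInput_half (ℓ : ℕ) : markovInput ℓ (1 / 2) = fun _ => ((1 : ℝ) / 2) ^ ℓ := by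
  funext x
  have h (i : Fin ℓ) : (if (i : ℕ) = 0 then (1 / 2 : ℝ)
      else if x i ≠ x ⟨i - 1, by omega⟩ then 1 / 2 else 1 - 1 / 2) = 1 / 2 := by
    split_ifs <;> norm_num
  simp only [markovInput, h]
  simp

theorem const_mem_stdSimplex (ℓ : ℕ) :
    (fun _ => ((1 : ℝ) / 2) ^ ℓ) ∈ stdSimplex ℝ (Fin ℓ → Bool) :=
  ⟨fun _ => by positivity, by simp ⟩

theorem entropy_uniform (ℓ : ℕ) : entropy (fun _ : Fin ℓ → Bool => ((1 : ℝ) / 2) ^ ℓ) = ℓ := by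
  rw [entropy_const _ (by simp ), logb_pow, one_div, logb_inv,
    logb_self_eq_one one_lt_two]
  simp

/-! ### The mean runlength entropy -/

/-- Once the bit value of the run is chosen, the interval and its existing neighbours are fixed and
all else is free. A neighbour missing at an end of the block doubles the count. -/
theorem card_filter_mem_runs {ℓ : ℕ} {a b : Fin ℓ} (hab : a ≤ b) :
    ((Finset.univ.filter fun x : Fin ℓ → Bool => (a, b) ∈ runs x).card : ℝ) =
      2 ^ ℓ * ((1 / 2) ^ ((b : ℕ) - a + 2) * (1 + if (a : ℕ) = 0 then 1 else 0) *
        (1 + if (b : ℕ) + 1 = ℓ then 1 else 0)) := by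
  have ha := a.isLt
  have hb := b.isLt
  -- The interval with its neighbours, clipped to the block: truncated subtraction handles a = 0 and
  -- `min` the right end.
  set S : Finset (Fin ℓ) := Finset.Icc ⟨a - 1, by omega⟩ ⟨min (b + 1) (ℓ - 1), by omega⟩ with hS
  have hmem (j : Fin ℓ) : j ∈ S ↔ (a : ℕ) ≤ j + 1 ∧ (j : ℕ) ≤ b + 1 := by
    simp only [hS, Finset.mem_Icc, Fin.le_def]
    omega
  have hcard : S.card = min ((b : ℕ) + 1) (ℓ - 1) + 1 - (a - 1) := by simp [hS]
  let v (c : Bool) (j : Fin ℓ) : Bool := if a ≤ j ∧ j ≤ b then c else !c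
  have hsplit : (Finset.univ.filter fun x : Fin ℓ → Bool => (a, b) ∈ runs x) =
      (Finset.univ.filter fun x : Fin ℓ → Bool => ∀ j ∈ S, x j = v false j) ∪
      (Finset.univ.filter fun x : Fin ℓ → Bool => ∀ j ∈ S, x j = v true j) := by
    ext x
    have hc (c : Bool) (hx : ∀ j ∈ S, x j = v c j) : (a, b) ∈ runs x := by
      have hxa : x a = c := by
        rw [hx a ((hmem a).2 (by omega))]
        simp [v, hab]
      simp only [runs, Finset.mem_filter, Finset.mem_univ, true_and]
      refine ⟨hab, fun j h1 h2 => ?_, fun j hj => ?_, fun j hj => ?_⟩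
      · rw [hxa, hx j ((hmem j).2 (by omega))]
        simp [v, h1, h2]
      · rw [hxa, hx j ((hmem j).2 (by omega))]
        have : ¬ (a ≤ j ∧ j ≤ b) := by omega
        simp [v, this]
      · rw [hxa, hx j ((hmem j).2 (by omega))]
        have : ¬ (a ≤ j ∧ j ≤ b) := by omega
        simp [v, this]
    have hr (h : (a, b) ∈ runs x) : ∀ j ∈ S, x j = v (x a) j := by
      simp only [runs, Finset.mem_filter, Finset.mem_univ, true_and] at h
      obtain ⟨-, h2, h3, h4⟩ := h
      intro j hj
      rw [hmem] at hj
      simp only [v]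
      split_ifs with hin
      · exact h2 j hin.1 hin.2
      · rcases (show (j : ℕ) + 1 = a ∨ (j : ℕ) = b + 1 by omega) with e | e
        · exact Bool.eq_not.2 (h3 j e)
        · exact Bool.eq_not.2 (h4 j e)
    simp only [Finset.mem_union, Finset.mem_filter, Finset.mem_univ, true_and]
    refine ⟨fun h => ?_, fun h => h.elim (hc _) (hc _)⟩
    have := hr h
    cases hxa : x a <;> rw [hxa] at this
    · exact .inl this
    · exact .inr this
  have hdisj : Disjoint
      (Finset.univ.filter fun x : Fin ℓ → Bool => ∀ j ∈ S, x j = v false j)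
      (Finset.univ.filter fun x : Fin ℓ → Bool => ∀ j ∈ S, x j = v true j) := by
    rw [Finset.disjoint_filter]
    intro x _ h1 h2
    have haS : a ∈ S := (hmem a).2 (by omega)
    have := (h1 a haS).symm.trans (h2 a haS)
    simp [v, hab] at this
  rw [hsplit, Finset.card_union_of_disjoint hdisj, card_filter_forall_mem_eq,
    card_filter_forall_mem_eq, ← two_mul]
  have hSle : S.card ≤ ℓ := by simpa using S.card_le_univ
  have hpow : (2 : ℝ) ^ ℓ = 2 ^ (ℓ - S.card) * 2 ^ S.card := by
    rw [← pow_add, Nat.sub_add_cancel hSle]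
  have hkey : (2 : ℝ) ^ S.card * ((1 / 2) ^ ((b : ℕ) - a + 2) *
      (1 + if (a : ℕ) = 0 then 1 else 0) * (1 + if (b : ℕ) + 1 = ℓ then 1 else 0)) = 2 := by
    set n := (b : ℕ) - a
    have e (m : ℕ) : (2 : ℝ) ^ m * (1 / 2) ^ m = 1 := by rw [← mul_pow]; norm_num
    have e' := e n
    split_ifs with h1 h2 h2
    · rw [show S.card = n + 1 by omega, pow_add, pow_add]
      linear_combination 2 * e'
    · rw [show S.card = n + 2 by omega, pow_add, pow_add]
      linear_combination 2 * e'
    · rw [show S.card = n + 2 by omega, pow_add, pow_add]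
      linear_combination 2 * e'
    · rw [show S.card = n + 3 by omega, pow_add, pow_add]
      linear_combination 2 * e'
  rw [hpow, mul_assoc, hkey]
  push_cast
  ring

/-- The mean over all blocks of the sum of `r log r` over the run lengths `r`. -/
noncomputable def meanRunSum (ℓ : ℕ) : ℝ :=
  (1 / 2) ^ ℓ * ∑ x : Fin ℓ → Bool, ∑ s ∈ runs x, (runLength s : ℝ) * logb 2 (runLength s)

theorem meanRunSum_eq (ℓ : ℕ) :
    meanRunSum ℓ = ∑ a : Fin ℓ, ∑ b : Fin ℓ, if a ≤ b then seriesTerm ((b : ℕ) - a) *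
      (1 + if (a : ℕ) = 0 then 1 else 0) * (1 + if (b : ℕ) + 1 = ℓ then 1 else 0) else 0 := by
  have h1 (x : Fin ℓ → Bool) : ∑ s ∈ runs x, (runLength s : ℝ) * logb 2 (runLength s) =
      ∑ s : Fin ℓ × Fin ℓ, if s ∈ runs x then (runLength s : ℝ) * logb 2 (runLength s) else 0 := by
    simp
  simp only [meanRunSum, h1]
  rw [Finset.sum_comm, Fintype.sum_prod_type, Finset.mul_sum]
  refine Finset.sum_congr rfl fun a _ => ?_
  rw [Finset.mul_sum]
  refine Finset.sum_congr rfl fun b _ => ?_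
  rw [← Finset.sum_filter, Finset.sum_const, nsmul_eq_mul]
  by_cases hab : a ≤ b
  · rw [card_filter_mem_runs hab, if_pos hab]
    have hr : (runLength (a, b) : ℝ) = (((b : ℕ) - a : ℕ) : ℝ) + 1 := by
      rw [runLength, ← Nat.cast_add_one]
      congr 1
      simp only
      omega
    have e : (1 / 2 : ℝ) ^ ℓ * 2 ^ ℓ = 1 := by rw [← mul_pow]; norm_num
    rw [hr, seriesTerm, one_div_pow (n := (b : ℕ) - a + 2)]
    linear_combination ((((b : ℕ) - a : ℕ) : ℝ) + 1) * logb 2 ((((b : ℕ) - a : ℕ) : ℝ) + 1) /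
      2 ^ ((b : ℕ) - a + 2) * (1 + if (a : ℕ) = 0 then 1 else 0) *
        (1 + if (b : ℕ) + 1 = ℓ then 1 else 0) * e
  · have : (Finset.univ.filter fun x : Fin ℓ → Bool => (a, b) ∈ runs x) = ∅ := by
      rw [Finset.filter_eq_empty_iff]
      intro x _ h
      simp only [runs, Finset.mem_filter] at h
      exact hab h.2.1
    simp [this, hab]

theorem sum_seriesTerm_sub (ℓ : ℕ) :
    ∑ a : Fin ℓ, ∑ b : Fin ℓ, (if a ≤ b then seriesTerm ((b : ℕ) - a) else 0) =
      ∑ n ∈ Finset.range ℓ, ∑ i ∈ Finset.range (n + 1), seriesTerm i := by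
  rw [← Finset.sum_range_reflect]
  rw [← Fin.sum_univ_eq_sum_range
    (fun n => ∑ i ∈ Finset.range (ℓ - 1 - n + 1), seriesTerm i) ℓ]
  refine Finset.sum_congr rfl fun a _ => ?_
  have := Fin.sum_univ_eq_sum_range
    (fun n => if (a : ℕ) ≤ n then seriesTerm (n - a) else 0) ℓ
  simp only [Fin.le_def, this]
  rw [← Finset.sum_filter, show (Finset.range ℓ).filter (fun n => (a : ℕ) ≤ n) =
    Finset.Ico (a : ℕ) ℓ by ext n; simp [and_comm], Finset.sum_Ico_eq_sum_range]
  have := a.isLt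
  rw [show ℓ - 1 - (a : ℕ) + 1 = ℓ - a by omega]
  simp

theorem sum_tailBound_le (ℓ : ℕ) : ∑ n ∈ Finset.range ℓ, tailBound (n + 1) ≤ 8 := by
  -- In fact an equality: the subtracted fraction is the exact remainder of a series with sum 8.
  have h (m : ℕ) : ∑ n ∈ Finset.range m, tailBound (n + 1) ≤
      8 - (2 * ((m : ℝ) + 1) ^ 2 + 10 * (m + 1) + 20) / 2 ^ (m + 2) := by
    induction m with
    | zero => norm_num
    | succ m ih =>
      rw [Finset.sum_range_succ]
      refine (add_le_add_left ih _).trans (le_of_eq ?_)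
      unfold tailBound
      push_cast
      field_simp
      ring
  refine (h ℓ).trans (sub_le_self _ (by positivity))

theorem K_nonneg : 0 ≤ K := tsum_nonneg seriesTerm_nonneg

/-- The boundary factors are at least 1 and are dropped. What remains is a sum of ℓ partial sums of
K, whose total shortfall is at most the sum of the tails. -/
theorem le_meanRunSum (ℓ : ℕ) : ℓ * K - 8 ≤ meanRunSum ℓ := by
  have h1 : ∑ a : Fin ℓ, ∑ b : Fin ℓ, (if a ≤ b then seriesTerm ((b : ℕ) - a) else 0) ≤
      meanRunSum ℓ := by
    rw [meanRunSum_eq]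
    refine Finset.sum_le_sum fun a _ => Finset.sum_le_sum fun b _ => ?_
    have := seriesTerm_nonneg ((b : ℕ) - a)
    split_ifs <;> nlinarith
  have h2 : ∑ n ∈ Finset.range ℓ, (K - tailBound (n + 1)) ≤
      ∑ n ∈ Finset.range ℓ, ∑ i ∈ Finset.range (n + 1), seriesTerm i :=
    Finset.sum_le_sum fun n _ => by linarith [K_le_sum_seriesTerm_add_tailBound (n + 1)]
  rw [sum_seriesTerm_sub] at h1
  rw [Finset.sum_sub_distrib] at h2
  simp only [Finset.sum_const, Finset.card_range, nsmul_eq_mul] at h2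
  linarith [sum_tailBound_le ℓ]

theorem meanRunSum_le (ℓ : ℕ) : meanRunSum ℓ ≤ ℓ * K + 3 * K := by
  -- For indicators α, β of the two ends, (1+α)(1+β) ≤ 1 + α + 2β; each boundary sum is at most K,
  -- hence the excess 3K.
  have h1 : meanRunSum ℓ ≤
      ∑ a : Fin ℓ, ∑ b : Fin ℓ, ((if a ≤ b then seriesTerm ((b : ℕ) - a) else 0) +
        (if (a : ℕ) = 0 then seriesTerm b else 0) +
        2 * if (b : ℕ) + 1 = ℓ then seriesTerm (ℓ - 1 - a) else 0) := by
    rw [meanRunSum_eq]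
    refine Finset.sum_le_sum fun a _ => Finset.sum_le_sum fun b _ => ?_
    have hb := seriesTerm_nonneg b
    have ha := seriesTerm_nonneg (ℓ - 1 - a)
    have hab := seriesTerm_nonneg ((b : ℕ) - a)
    have e1 : (a : ℕ) = 0 → seriesTerm ((b : ℕ) - a) = seriesTerm b := fun h => by simp [h]
    have e2 : (b : ℕ) + 1 = ℓ → seriesTerm ((b : ℕ) - a) = seriesTerm (ℓ - 1 - a) := fun h => by
      rw [show ℓ - 1 = (b : ℕ) by omega]
    generalize seriesTerm ((b : ℕ) - a) = u at *
    split_ifs <;> first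
      | linarith
      | linarith [e1 ‹_›]
      | linarith [e2 ‹_›]
      | linarith [e1 ‹_›, e2 ‹_›]
  have h2 : ∑ n ∈ Finset.range ℓ, ∑ i ∈ Finset.range (n + 1), seriesTerm i ≤ ℓ * K := by
    refine (Finset.sum_le_sum fun n _ => sum_seriesTerm_le_K (n + 1)).trans (le_of_eq ?_)
    simp
  have h3 : ∑ a : Fin ℓ, ∑ b : Fin ℓ, (if (a : ℕ) = 0 then seriesTerm b else 0) ≤ K := by
    rcases Nat.eq_zero_or_pos ℓ with rfl | hℓ
    · simpa using K_nonneg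
    rw [Finset.sum_eq_single (⟨0, hℓ⟩ : Fin ℓ)]
    · simpa [Fin.sum_univ_eq_sum_range] using sum_seriesTerm_le_K ℓ
    · intro a _ ha
      have : (a : ℕ) ≠ 0 := fun h => ha (Fin.ext h)
      simp [this]
    · simp
  have h4 : ∑ a : Fin ℓ, ∑ b : Fin ℓ,
      (if (b : ℕ) + 1 = ℓ then seriesTerm (ℓ - 1 - a) else 0) ≤ K := by
    rcases Nat.eq_zero_or_pos ℓ with rfl | hℓ
    · simpa using K_nonneg
    rw [Finset.sum_comm, Finset.sum_eq_single (⟨ℓ - 1, by omega⟩ : Fin ℓ)]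
    · have := Fin.sum_univ_eq_sum_range (fun n => seriesTerm (ℓ - 1 - n)) ℓ
      simp only [Nat.sub_add_cancel hℓ, if_true, this]
      rw [Finset.sum_range_reflect]
      exact sum_seriesTerm_le_K ℓ
    · intro b _ hb
      have : (b : ℕ) + 1 ≠ ℓ := fun h => hb (Fin.ext (by simp only; omega))
      simp [this]
    · simp
  simp only [Finset.sum_add_distrib, ← Finset.mul_sum] at h1
  rw [sum_seriesTerm_sub] at h1
  linarith

/-- The mean of the runlength entropy over all blocks. -/
noncomputable def meanRunEntropy (ℓ : ℕ) : ℝ :=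
  ∑ x : Fin ℓ → Bool, (1 / 2) ^ ℓ * runEntropy x

theorem abs_meanRunEntropy_sub_le {ℓ : ℕ} (hℓ : 0 < ℓ) :
    |meanRunEntropy ℓ - (logb 2 ℓ - K)| ≤ 8 / ℓ := by
  have hℓ' : (0 : ℝ) < ℓ := by exact_mod_cast hℓ
  have h : meanRunEntropy ℓ = logb 2 ℓ - meanRunSum ℓ / ℓ := by
    simp only [meanRunEntropy, meanRunSum, runEntropy_eq hℓ, mul_sub, Finset.sum_sub_distrib,
      Finset.mul_sum, Finset.sum_div, mul_div_assoc]
    congr 1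
    simp
  -- The numerical value serves only to give 3K ≤ 8.
  have hK := (abs_lt.1 abs_K_sub_lt).2
  have e : meanRunEntropy ℓ - (logb 2 ℓ - K) = (ℓ * K - meanRunSum ℓ) / ℓ := by
    rw [h]
    field_simp
    ring
  rw [e, abs_div, abs_of_pos hℓ']
  gcongr
  rw [abs_le]
  constructor <;> linarith [le_meanRunSum ℓ, meanRunSum_le ℓ]

/-! ### The partition function -/

/-- The logarithm of the partition function of the runlength entropy. -/
noncomputable def logPartition (ℓ : ℕ) (s : ℝ) : ℝ :=
  logb 2 (∑ x : Fin ℓ → Bool, (2 : ℝ) ^ (-s * runEntropy x))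

theorem entropy_sub_le_logPartition {ℓ : ℕ} (s : ℝ) (P : (Fin ℓ → Bool) → ℝ)
    (hP : P ∈ stdSimplex ℝ (Fin ℓ → Bool)) :
    entropy P - s * ∑ x, P x * runEntropy x ≤ logPartition ℓ s := by
  have h := sum_mul_logb_add_entropy_le P (fun x => (2 : ℝ) ^ (-s * runEntropy x)) hP
    fun x => by positivity
  simp only [logb_rpow two_pos (by norm_num : (2 : ℝ) ≠ 1)] at h
  have e : ∑ x, P x * (-s * runEntropy x) = -(s * ∑ x, P x * runEntropy x) := by
    rw [Finset.mul_sum, ← Finset.sum_neg_distrib]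
    exact Finset.sum_congr rfl fun x _ => by ring
  rw [e] at h
  rw [logPartition]
  linarith

theorem le_logPartition (ℓ : ℕ) (s : ℝ) : ℓ - s * meanRunEntropy ℓ ≤ logPartition ℓ s := by
  have h := entropy_sub_le_logPartition s _ (const_mem_stdSimplex ℓ)
  rwa [entropy_uniform] at h

/-- From 1 + u ≤ exp u and (1 + u)(1 - u + u²) = 1 + u³ ≥ 1. No smallness of u is needed. -/
theorem exp_neg_le {u : ℝ} (hu : 0 ≤ u) : exp (-u) ≤ 1 - u + u ^ 2 := by
  rw [exp_neg]
  refine inv_le_of_inv_le₀ (by nlinarith) ?_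
  refine le_trans ?_ (Real.add_one_le_exp u)
  rw [inv_le_iff_one_le_mul₀ (by nlinarith)]
  nlinarith [pow_nonneg hu 3]

theorem logPartition_le {ℓ : ℕ} (hℓ : 0 < ℓ) {s : ℝ} (hs : 0 ≤ s) :
    logPartition ℓ s ≤ ℓ - s * meanRunEntropy ℓ + s ^ 2 * logb 2 ℓ ^ 2 := by
  have hl : 0 < log 2 := log_pos one_lt_two
  have hl1 : log 2 ≤ 1 := by linarith [log_two_lt_d9]
  have hbound (x : Fin ℓ → Bool) : (1 / 2) ^ ℓ * (2 : ℝ) ^ (-s * runEntropy x) ≤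
      (1 / 2) ^ ℓ * (1 + log 2 * (s ^ 2 * logb 2 ℓ ^ 2)) -
        log 2 * s * ((1 / 2) ^ ℓ * runEntropy x) := by
    have h0 := runEntropy_nonneg x
    have h1 := runEntropy_le hℓ x
    have h2 : (2 : ℝ) ^ (-s * runEntropy x) = exp (-(log 2 * s * runEntropy x)) := by
      rw [rpow_def_of_pos two_pos]
      congr 1
      ring
    have h3 := exp_neg_le (mul_nonneg (mul_nonneg hl.le hs) h0)
    -- One factor log 2 is bounded by 1; the other is kept to cancel the change of base at the end.
    have h4 : (log 2 * s * runEntropy x) ^ 2 ≤ log 2 * (s ^ 2 * logb 2 ℓ ^ 2) := by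
      calc (log 2 * s * runEntropy x) ^ 2 = log 2 * log 2 * (s ^ 2 * runEntropy x ^ 2) := by ring
        _ ≤ log 2 * 1 * (s ^ 2 * logb 2 ℓ ^ 2) := by gcongr
        _ = _ := by ring
    rw [h2]
    calc _ ≤ (1 / 2) ^ ℓ * (1 - log 2 * s * runEntropy x + log 2 * (s ^ 2 * logb 2 ℓ ^ 2)) := by
          gcongr
          linarith
      _ = _ := by ring
  have hsum := Finset.sum_le_sum fun x (_ : x ∈ Finset.univ) => hbound x
  have hone : ∑ _x : Fin ℓ → Bool, ((1 : ℝ) / 2) ^ ℓ = 1 := (const_mem_stdSimplex ℓ).2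
  rw [Finset.sum_sub_distrib, ← Finset.sum_mul, hone, one_mul, ← Finset.mul_sum,
    ← Finset.mul_sum] at hsum
  have hpos : 0 < ∑ x : Fin ℓ → Bool, (2 : ℝ) ^ (-s * runEntropy x) :=
    Finset.sum_pos (fun x _ => by positivity) Finset.univ_nonempty
  have hlog : logb 2 (∑ x : Fin ℓ → Bool, (2 : ℝ) ^ (-s * runEntropy x)) =
      ℓ + logb 2 ((1 / 2) ^ ℓ * ∑ x : Fin ℓ → Bool, (2 : ℝ) ^ (-s * runEntropy x)) := by
    rw [logb_mul (by positivity) hpos.ne', logb_pow, one_div, logb_inv,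
      logb_self_eq_one one_lt_two]
    ring
  have h5 := log_le_sub_one_of_pos
    (mul_pos (by positivity : (0 : ℝ) < (1 / 2) ^ ℓ) hpos)
  rw [logPartition, hlog, logb]
  have h6 : log ((1 / 2) ^ ℓ * ∑ x : Fin ℓ → Bool, (2 : ℝ) ^ (-s * runEntropy x)) / log 2 ≤
      s ^ 2 * logb 2 ℓ ^ 2 - s * meanRunEntropy ℓ := by
    rw [div_le_iff₀ hl]
    unfold meanRunEntropy
    linarith
  linarith

/-! ### The expansions and their error terms -/

/-- The trivial ℓ + 1 stands where `upperBound` has log(2^(ℓ+1) - 2): slightly weaker, but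
sufficient for the capacity. -/
theorem mutualInfo_le {ℓ : ℕ} (hℓ : 0 < ℓ) {p q : ℝ} (hp : 0 ≤ p) (hq : 0 ≤ q) (hpq : p + q < 1)
    (P : (Fin ℓ → Bool) → ℝ) (hP : P ∈ stdSimplex ℝ (Fin ℓ → Bool)) :
    mutualInfo P (channel p q) ≤ p * (ℓ - 1) + q * (ℓ + 1) +
      (1 - p - q) * logPartition ℓ ((p + q) / (1 - p - q)) := by
  have hpos : 0 < 1 - p - q := by linarith
  rw [mutualInfo_channel hℓ p q P hP.2 runEntropy entropy_hitLaw_deleteBit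
    entropy_hitLaw_duplicateBit]
  have h1 := entropy_le_logb_card _ (mixture_mem_stdSimplex P _ hP fun x =>
    hitLaw_mem_stdSimplex hℓ (deleteBit x))
  have h2 := entropy_le_logb_card _ (mixture_mem_stdSimplex P _ hP fun x =>
    hitLaw_mem_stdSimplex hℓ (duplicateBit x))
  simp only [Fintype.card_pi, Fintype.card_bool, Finset.prod_const, Finset.card_univ,
    Fintype.card_fin, Nat.cast_pow, Nat.cast_ofNat, logb_pow, logb_self_eq_one one_lt_two,
    mul_one, Nat.cast_sub (Nat.one_le_iff_ne_zero.2 hℓ.ne'), Nat.cast_add, Nat.cast_one] at h1 h2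
  have h3 := mul_le_mul_of_nonneg_left
    (entropy_sub_le_logPartition ((p + q) / (1 - p - q)) P hP) hpos.le
  have e : (1 - p - q) * (entropy P - (p + q) / (1 - p - q) * ∑ x, P x * runEntropy x) =
      (1 - p - q) * entropy P - (p + q) * ∑ x, P x * runEntropy x := by
    field_simp
  linarith [mul_le_mul_of_nonneg_left h1 hp, mul_le_mul_of_nonneg_left h2 hq]

theorem capacity_le {ℓ : ℕ} (hℓ : 0 < ℓ) {p q : ℝ} (hp : 0 ≤ p) (hq : 0 ≤ q) (hpq : p + q < 1) :
    capacity ℓ p q ≤ (p * (ℓ - 1) + q * (ℓ + 1) +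
      (1 - p - q) * logPartition ℓ ((p + q) / (1 - p - q))) / ℓ := by
  unfold capacity
  gcongr
  obtain ⟨P, hP, h⟩ := (exists_optimal_input ℓ p q).1
  rw [← h]
  exact mutualInfo_le hℓ hp hq hpq P hP

theorem lowerBound_half_le_capacity (ℓ : ℕ) (p q : ℝ) :
    lowerBound ℓ p q (1 / 2) ≤ capacity ℓ p q := by
  unfold lowerBound capacity
  gcongr
  rw [markovInput_half]
  exact (exists_optimal_input ℓ p q).2 ⟨_, const_mem_stdSimplex ℓ, rfl⟩

/-- The deviation from the main part of the expansions, before normalization by `ℓ`. -/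
theorem abs_weighted_meanRunEntropy_sub_le {ℓ : ℕ} (hℓ : 0 < ℓ) {p q : ℝ} (hp : 0 ≤ p)
    (hq : 0 ≤ q) :
    |(p * (ℓ - 1) + q * (ℓ + 1) + (1 - p - q) * ℓ - (p + q) * meanRunEntropy ℓ) -
      ℓ * expansion ℓ p q| ≤ 8 * ((p + q) / ℓ) := by
  have hℓ' : (0 : ℝ) < ℓ := by exact_mod_cast hℓ
  have e : (p * (ℓ - 1) + q * (ℓ + 1) + (1 - p - q) * ℓ - (p + q) * meanRunEntropy ℓ) -
      ℓ * expansion ℓ p q = -((p + q) * (meanRunEntropy ℓ - (logb 2 ℓ - K))) := by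
    unfold expansion
    field_simp
    ring
  rw [e, abs_neg, abs_mul, abs_of_nonneg (add_nonneg hp hq)]
  calc _ ≤ (p + q) * (8 / ℓ) := by
        gcongr
        exact abs_meanRunEntropy_sub_le hℓ
    _ = _ := by ring

theorem abs_lowerBound_sub_expansion_le {ℓ : ℕ} (hℓ : 0 < ℓ) {p q : ℝ} (hp : 0 ≤ p)
    (hq : 0 ≤ q) :
    |lowerBound ℓ p q (1 / 2) - expansion ℓ p q| ≤ 10 * ((p + q) / (ℓ : ℝ) ^ 2) := by
  have hℓ' : (0 : ℝ) < ℓ := by exact_mod_cast hℓ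
  have h := mutualInfo_channel hℓ p q _ (const_mem_stdSimplex ℓ).2 runEntropy
    entropy_hitLaw_deleteBit entropy_hitLaw_duplicateBit
  rw [entropy_mixture_deleteBit hℓ, entropy_uniform] at h
  change _ = _ - (p + q) * meanRunEntropy ℓ at h
  have h1 := le_entropy_mixture_duplicateBit hℓ
  have h2 := entropy_le_logb_card _ (mixture_mem_stdSimplex _ _ (const_mem_stdSimplex ℓ) fun x =>
    hitLaw_mem_stdSimplex hℓ (duplicateBit x))
  simp only [Fintype.card_pi, Fintype.card_bool, Finset.prod_const, Finset.card_univ,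
    Fintype.card_fin, Nat.cast_pow, Nat.cast_ofNat, logb_pow, logb_self_eq_one one_lt_two,
    mul_one, Nat.cast_add, Nat.cast_one] at h2
  have h3 := abs_le.1 (abs_weighted_meanRunEntropy_sub_le hℓ hp hq)
  have e : lowerBound ℓ p q (1 / 2) - expansion ℓ p q =
      (mutualInfo (fun _ : Fin ℓ → Bool => (1 / 2) ^ ℓ) (channel p q) - ℓ * expansion ℓ p q) / ℓ := by
    rw [lowerBound, markovInput_half]
    field_simp
  -- The constant 10 is 8 from the mean runlength entropy plus 2 from the duplicated string.
  rw [e, abs_div, abs_of_pos hℓ', div_le_iff₀ hℓ', h,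
    show 10 * ((p + q) / (ℓ : ℝ) ^ 2) * ℓ = 8 * ((p + q) / ℓ) + 2 * (p / ℓ) + q * (2 / ℓ) by
      field_simp; ring]
  have h4 := mul_le_mul_of_nonneg_left h1 hq
  have h5 := mul_le_mul_of_nonneg_left h2 hq
  have h6 : 0 ≤ p / ℓ := by positivity
  have h7 : 0 ≤ q * (2 / ℓ) := by positivity
  rw [abs_le]
  constructor <;> linarith

/-- With s = t/(1-t), the quadratic error becomes (1-t)s² = t²/(1-t) ≤ 2t². -/
theorem logPartition_error_bounds {ℓ : ℕ} (hℓ : 0 < ℓ) {t : ℝ} (ht : 0 ≤ t) (ht' : t ≤ 1 / 2) :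
    (1 - t) * ℓ - t * meanRunEntropy ℓ ≤ (1 - t) * logPartition ℓ (t / (1 - t)) ∧
    (1 - t) * logPartition ℓ (t / (1 - t)) ≤
      (1 - t) * ℓ - t * meanRunEntropy ℓ + 2 * (t ^ 2 * logb 2 ℓ ^ 2) := by
  have hpos : 0 < 1 - t := by linarith
  have e : (1 - t) * (ℓ - t / (1 - t) * meanRunEntropy ℓ) =
      (1 - t) * ℓ - t * meanRunEntropy ℓ := by
    field_simp
  have h1 := mul_le_mul_of_nonneg_left (le_logPartition ℓ (t / (1 - t))) hpos.le
  have h2 := mul_le_mul_of_nonneg_left (logPartition_le hℓ (div_nonneg ht hpos.le)) hpos.le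
  refine ⟨by linarith, h2.trans ?_⟩
  rw [mul_add, e]
  refine add_le_add le_rfl ?_
  have e2 : (1 - t) * ((t / (1 - t)) ^ 2 * logb 2 ℓ ^ 2) =
      (1 / (1 - t)) * (t ^ 2 * logb 2 ℓ ^ 2) := by
    field_simp
  rw [e2]
  gcongr
  rw [div_le_iff₀ hpos]
  linarith

/-- Factoring out 2^(ℓ+1) leaves log(1 - 2^(-ℓ)), whose natural logarithm is at least -1/(2^ℓ - 1) ≥
-1/ℓ. The loss is exponentially small, but 1/ℓ suffices. -/
theorem logb_two_pow_sub_two_bounds {ℓ : ℕ} (hℓ : 0 < ℓ) :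
    (ℓ : ℝ) + 1 - 4 / ℓ ≤ logb 2 ((2 : ℝ) ^ (ℓ + 1) - 2) ∧
      logb 2 ((2 : ℝ) ^ (ℓ + 1) - 2) ≤ ℓ + 1 := by
  have hℓ' : (0 : ℝ) < ℓ := by exact_mod_cast hℓ
  have h2 : (2 : ℝ) ≤ 2 ^ ℓ := by simpa using pow_le_pow_right₀ one_le_two hℓ
  have hpow : (ℓ : ℝ) ≤ 2 ^ ℓ - 1 := by
    have : ℓ + 1 ≤ 2 ^ ℓ := ℓ.lt_two_pow_self
    have : (ℓ : ℝ) + 1 ≤ 2 ^ ℓ := by exact_mod_cast this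
    linarith
  have hl : 0 < log 2 := log_pos one_lt_two
  have hpos : (0 : ℝ) < 1 - (2 ^ ℓ)⁻¹ := by
    have : ((2 : ℝ) ^ ℓ)⁻¹ < 1 := inv_lt_one_of_one_lt₀ (by linarith)
    linarith
  have e : logb 2 ((2 : ℝ) ^ (ℓ + 1) - 2) = ℓ + 1 + log (1 - (2 ^ ℓ)⁻¹) / log 2 := by
    rw [show (2 : ℝ) ^ (ℓ + 1) - 2 = 2 ^ (ℓ + 1) * (1 - (2 ^ ℓ)⁻¹) by
      rw [pow_succ]; field_simp, logb_mul (by positivity) hpos.ne', logb_pow,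
      logb_self_eq_one one_lt_two, log_div_log]
    push_cast
    ring
  have h3 := one_sub_inv_le_log_of_pos hpos
  have h4 : log (1 - ((2 : ℝ) ^ ℓ)⁻¹) ≤ 0 :=
    log_nonpos hpos.le (by linarith [inv_nonneg.2 (by positivity : (0 : ℝ) ≤ 2 ^ ℓ)])
  have h5 : 1 - (1 - ((2 : ℝ) ^ ℓ)⁻¹)⁻¹ = -(1 / (2 ^ ℓ - 1)) := by
    have : (2 : ℝ) ^ ℓ - 1 ≠ 0 := by linarith
    field_simp
    ring
  have h6 : 1 / ((2 : ℝ) ^ ℓ - 1) ≤ 1 / ℓ := one_div_le_one_div_of_le hℓ' hpow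
  rw [e]
  constructor
  · have h7 : -(1 / (ℓ : ℝ)) / log 2 ≤ log (1 - (2 ^ ℓ)⁻¹) / log 2 := by
      gcongr
      linarith
    have h8 : 1 / (ℓ : ℝ) * (1 / log 2) ≤ 1 / ℓ * 2 := by
      gcongr
      exact one_div_log_two_le
    have h9 : -(1 / (ℓ : ℝ)) / log 2 = -(1 / (ℓ : ℝ) * (1 / log 2)) := by ring
    have h10 : (4 : ℝ) / ℓ = 4 * (1 / ℓ) := by ring
    have h11 : 0 < 1 / (ℓ : ℝ) := by positivity
    linarith
  · linarith [div_nonpos_of_nonpos_of_nonneg h4 hl.le]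

theorem abs_upperBound_sub_expansion_le {ℓ : ℕ} (hℓ : 0 < ℓ) {p q : ℝ} (hp : 0 ≤ p)
    (hq : 0 ≤ q) (hpq : p + q ≤ 1 / 2) :
    |upperBound ℓ p q - expansion ℓ p q| ≤
      12 * ((p + q) / (ℓ : ℝ) ^ 2 + (p + q) ^ 2 * logb 2 ℓ ^ 2 / ℓ) := by
  have hℓ' : (0 : ℝ) < ℓ := by exact_mod_cast hℓ
  have e : upperBound ℓ p q - expansion ℓ p q =
      (p * (ℓ - 1) + q * logb 2 ((2 : ℝ) ^ (ℓ + 1) - 2) +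
        (1 - (p + q)) * logPartition ℓ ((p + q) / (1 - (p + q))) - ℓ * expansion ℓ p q) / ℓ := by
    rw [upperBound, logPartition, ← sub_sub]
    field_simp
  obtain ⟨h1, h2⟩ := logPartition_error_bounds hℓ (add_nonneg hp hq) hpq
  obtain ⟨h3, h4⟩ := logb_two_pow_sub_two_bounds hℓ
  have h5 := abs_le.1 (abs_weighted_meanRunEntropy_sub_le hℓ hp hq)
  rw [e, abs_div, abs_of_pos hℓ', div_le_iff₀ hℓ',
    show 12 * ((p + q) / (ℓ : ℝ) ^ 2 + (p + q) ^ 2 * logb 2 ℓ ^ 2 / ℓ) * ℓ =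
      12 * ((p + q) ^ 2 * logb 2 ℓ ^ 2) + 8 * ((p + q) / ℓ) + 4 * (p / ℓ) + q * (4 / ℓ) by
      field_simp; ring]
  have h6 := mul_le_mul_of_nonneg_left h3 hq
  have h7 := mul_le_mul_of_nonneg_left h4 hq
  have h8 : 0 ≤ p / ℓ := by positivity
  have h9 : 0 ≤ q * (4 / ℓ) := by positivity
  have h10 : 0 ≤ (p + q) ^ 2 * logb 2 ℓ ^ 2 := by positivity
  rw [abs_le]
  constructor <;> linarith

theorem abs_capacity_sub_expansion_le {ℓ : ℕ} (hℓ : 0 < ℓ) {p q : ℝ} (hp : 0 ≤ p)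
    (hq : 0 ≤ q) (hpq : p + q ≤ 1 / 2) :
    |capacity ℓ p q - expansion ℓ p q| ≤
      10 * ((p + q) / (ℓ : ℝ) ^ 2 + (p + q) ^ 2 * logb 2 ℓ ^ 2 / ℓ) := by
  have hℓ' : (0 : ℝ) < ℓ := by exact_mod_cast hℓ
  have h1 := (abs_le.1 (abs_lowerBound_sub_expansion_le hℓ hp hq)).1
  have h2 := lowerBound_half_le_capacity ℓ p q
  have h3 := capacity_le hℓ hp hq (by linarith)
  have h4 := (logPartition_error_bounds hℓ (add_nonneg hp hq) hpq).2
  have h5 := (abs_le.1 (abs_weighted_meanRunEntropy_sub_le hℓ hp hq)).2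
  have h6 : 0 ≤ (p + q) ^ 2 * logb 2 ℓ ^ 2 := by positivity
  have h7 : 0 ≤ (p + q) ^ 2 * logb 2 ℓ ^ 2 / ℓ := by positivity
  have h8 : 0 ≤ (p + q) / ℓ := by positivity
  rw [abs_le]
  refine ⟨by linarith, ?_⟩
  rw [← sub_sub] at h4
  have h9 : (p * (ℓ - 1) + q * (ℓ + 1) +
      (1 - p - q) * logPartition ℓ ((p + q) / (1 - p - q))) / ℓ ≤
      (ℓ * expansion ℓ p q + 10 * ((p + q) / ℓ) + 10 * ((p + q) ^ 2 * logb 2 ℓ ^ 2)) / ℓ := by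
    refine div_le_div_of_nonneg_right ?_ hℓ'.le
    linarith
  have e : (ℓ * expansion ℓ p q + 10 * ((p + q) / ℓ) + 10 * ((p + q) ^ 2 * logb 2 ℓ ^ 2)) / ℓ =
      expansion ℓ p q + 10 * ((p + q) / (ℓ : ℝ) ^ 2 + (p + q) ^ 2 * logb 2 ℓ ^ 2 / ℓ) := by
    field_simp
    ring
  linarith

theorem le_half_of_mul_logb_le {ℓ : ℕ} (hℓ : 2 ≤ ℓ) {t : ℝ} (ht : 0 ≤ t)
    (h : t * logb 2 ℓ ≤ 1 / 2) : t ≤ 1 / 2 := by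
  have hlog : 1 ≤ logb 2 (ℓ : ℝ) := by
    rw [← logb_self_eq_one one_lt_two]
    exact logb_le_logb_of_le one_lt_two two_pos (by exact_mod_cast hℓ)
  nlinarith

/-- The extra condition makes (p+q)/ℓ² at most 1/c times the quadratic error term. -/
theorem abs_upperBound_sub_expansion_le_of_le {ℓ : ℕ} (hℓ : 0 < ℓ) {p q c : ℝ} (hc : 0 < c)
    (hp : 0 ≤ p) (hq : 0 ≤ q) (hpq : p + q ≤ 1 / 2)
    (h : p + q = 0 ∨ c ≤ (p + q) * ℓ * logb 2 ℓ ^ 2) :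
    |upperBound ℓ p q - expansion ℓ p q| ≤
      12 * (1 / c + 1) * ((p + q) ^ 2 * logb 2 ℓ ^ 2 / ℓ) := by
  have hℓ' : (0 : ℝ) < ℓ := by exact_mod_cast hℓ
  refine (abs_upperBound_sub_expansion_le hℓ hp hq hpq).trans ?_
  rw [mul_assoc]
  gcongr
  rw [add_mul, one_mul]
  gcongr
  rcases h with h | h
  · simp [h]
  · have h0 : 0 ≤ p + q := add_nonneg hp hq
    calc (p + q) / (ℓ : ℝ) ^ 2 = 1 / c * ((p + q) / (ℓ : ℝ) ^ 2 * c) := by field_simp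
      _ ≤ 1 / c * ((p + q) / (ℓ : ℝ) ^ 2 * ((p + q) * ℓ * logb 2 ℓ ^ 2)) := by gcongr
      _ = _ := by field_simp

end OneBit

theorem theorem1 :
    -- the constant K
    (Summable (fun i : ℕ => ((i : ℝ) + 1) * Real.logb 2 ((i : ℝ) + 1) / 2 ^ (i + 2)) ∧
      |OneBit.K - 1.2885| < 0.00005) ∧
    -- (i) the bound achieved by uniform inputs
    (∃ C : ℝ, ∀ᶠ ℓ : ℕ in Filter.atTop, ∀ p q : ℝ, 0 ≤ p → 0 ≤ q → p + q ≤ 1 →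
      |OneBit.lowerBound ℓ p q (1 / 2) - OneBit.expansion ℓ p q| ≤
        C * ((p + q) / (ℓ : ℝ) ^ 2)) ∧
    -- (ii) the upper bound
    (∃ δ > 0, ∃ C : ℝ, ∀ᶠ ℓ : ℕ in Filter.atTop, ∀ p q : ℝ, 0 ≤ p → 0 ≤ q → p + q ≤ 1 →
      (p + q) * Real.logb 2 ℓ ≤ δ →
      |OneBit.upperBound ℓ p q - OneBit.expansion ℓ p q| ≤
        C * ((p + q) / (ℓ : ℝ) ^ 2 + (p + q) ^ 2 * Real.logb 2 ℓ ^ 2 / ℓ)) ∧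
    -- (ii) without the term of order (p + q) / ℓ ^ 2, when p + q is zero or not too small
    (∀ c > 0, ∃ δ > 0, ∃ C : ℝ, ∀ᶠ ℓ : ℕ in Filter.atTop, ∀ p q : ℝ,
      0 ≤ p → 0 ≤ q → p + q ≤ 1 → (p + q) * Real.logb 2 ℓ ≤ δ →
      (p + q = 0 ∨ c ≤ (p + q) * ℓ * Real.logb 2 ℓ ^ 2) →
      |OneBit.upperBound ℓ p q - OneBit.expansion ℓ p q| ≤
        C * ((p + q) ^ 2 * Real.logb 2 ℓ ^ 2 / ℓ)) ∧
    -- (iii) the capacity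
    (∃ δ > 0, ∃ C : ℝ, ∀ᶠ ℓ : ℕ in Filter.atTop, ∀ p q : ℝ, 0 ≤ p → 0 ≤ q → p + q ≤ 1 →
      (p + q) * Real.logb 2 ℓ ≤ δ →
      |OneBit.capacity ℓ p q - OneBit.expansion ℓ p q| ≤
        C * ((p + q) / (ℓ : ℝ) ^ 2 + (p + q) ^ 2 * Real.logb 2 ℓ ^ 2 / ℓ)) := by
  refine ⟨⟨OneBit.summable_seriesTerm, OneBit.abs_K_sub_lt⟩, ⟨10, ?_⟩, ⟨1 / 2, by norm_num, 12, ?_⟩,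
    fun c hc => ⟨1 / 2, by norm_num, 12 * (1 / c + 1), ?_⟩, ⟨1 / 2, by norm_num, 10, ?_⟩⟩
  · filter_upwards [Filter.eventually_gt_atTop 0] with ℓ hℓ p q hp hq _
    exact OneBit.abs_lowerBound_sub_expansion_le hℓ hp hq
  · filter_upwards [Filter.eventually_ge_atTop 2] with ℓ hℓ p q hp hq _ h
    exact OneBit.abs_upperBound_sub_expansion_le (by omega) hp hq
      (OneBit.le_half_of_mul_logb_le hℓ (add_nonneg hp hq) h)
  · filter_upwards [Filter.eventually_ge_atTop 2] with ℓ hℓ p q hp hq _ h h'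
    exact OneBit.abs_upperBound_sub_expansion_le_of_le (by omega) hc hp hq
      (OneBit.le_half_of_mul_logb_le hℓ (add_nonneg hp hq) h) h'
  · filter_upwards [Filter.eventually_ge_atTop 2] with ℓ hℓ p q hp hq _ h
    exact OneBit.abs_capacity_sub_expansion_le (by omega) hp hq
      (OneBit.le_half_of_mul_logb_le hℓ (add_nonneg hp hq) h)
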